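/- Let $d\ge 1$, let $E$ be a real $d\times d$ matrix all of whose complex eigenvalues have positive real part, let $a_1>0$ be the smallest of these real parts, and put $q=\operatorname{trace}(E)$. For $c>0$ write $c^E=\exp(E\log c)$, and let $E^t$ be the transpose of $E$. Let $\psi:\mathbb R^d\to[0,\infty)$ be continuous with $\psi(\xi)\ne 0$ for $\xi\neq 0$ and $\psi(c^{E^t}\xi)=c\,\psi(\xi)$ for all $c>0$ and $\xi\ne 0$. Let $0<\alpha\le 2$ and $0<H<a_1$. Let $W_\alpha$ be a complex isotropic symmetric $\alpha$-stable random measure on $\mathbb R^d$ with Lebesgue control measure, defined on a probability space: to each Borel set $A$ of finite Lebesgue measure $|A|$ it assigns a complex random variable $W_\alpha(A)$ with $$\mathbb E\exp\bigl(i\,\Re(\bar z\,W_\alpha(A))\bigr)=\exp\bigl(-\kappa\,|A|\,|z|^\alpha\bigr)\quad\text{for all } z\in\mathbb C,$$ where $\kappa>0$ is a fixed normalizing constant; its values on finitely many pairwise disjoint sets are independent; and $W_\alpha(\bigcup_i A_i)=\sum_i W_\alpha(A_i)$ almost surely for each sequence of pairwise disjoint Borel sets $A_i$ with $|\bigcup_i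 A_i|<\infty$. For $f\in L^\alpha(\mathbb R^d,\mathbb C)$ the integral $\int f\,dW_\alpha$ is the limit in probability of the integrals of simple functions converging to $f$ in $L^\alpha$. Then the random field $$X_\psi(x)=\Re\int_{\mathbb R^d}\bigl(e^{i\langle x,\xi\rangle}-1\bigr)\,\psi(\xi)^{-H-q/\alpha}\,W_\alpha(d\xi),\qquad x\in\mathbb R^d,$$ is well defined (the integrals exist), and (every version of) it has the following properties, where $\stackrel{f.d.}{=}$ denotes equality of all finite-dimensional marginal distributions: (a) (operator scaling with exponent $E$ and index $H$) for every $c>0$, $\{X_\psi(c^Ex)\}_{x\in\mathbb R^d}\stackrel{f.d.}{=}\{c^HX_\psi(x)\}_{x\in\mathbb R^d}$; (b) (stationary increments) for every $h\in\mathbb R^d$, $\{X_\psi(x+h)-X_\psi(h)\}_{x\in\mathbb R^d}\stackrel{f.d.}{=}\{X_\psi(x)\}_{x\in\mathbb R^d}$. -/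

import Mathlib

open MeasureTheory ProbabilityTheory Filter Topology
open scoped ENNReal

namespace OperatorScaling

/-- `ℝ^d` with its Euclidean inner product. -/
abbrev Rd (d : ℕ) : Type := EuclideanSpace ℝ (Fin d)

/-- The matrix `c^E = exp (E log c)`, meant for `c > 0`. -/
noncomputable def matPow {d : ℕ} (c : ℝ) (E : Matrix (Fin d) (Fin d) ℝ) :
    Matrix (Fin d) (Fin d) ℝ :=
  NormedSpace.exp (Real.log c • E)

/-- The vector `c^E x`. -/
noncomputable def powAct {d : ℕ} (c : ℝ) (E : Matrix (Fin d) (Fin d) ℝ) (x : Rd d) : Rd d :=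
  Matrix.toEuclideanLin (matPow c E) x

/-- The complex spectrum of a real matrix, i.e. the set of its complex eigenvalues. -/
def complexSpectrum {d : ℕ} (E : Matrix (Fin d) (Fin d) ℝ) : Set ℂ :=
  spectrum ℂ (E.map (algebraMap ℝ ℂ))

/-- `φ` is `E`-homogeneous: `φ (c^E x) = c φ x` for all `c > 0` and all `x ≠ 0`. -/
def IsHomogeneous {d : ℕ} (E : Matrix (Fin d) (Fin d) ℝ) (φ : Rd d → ℝ) : Prop :=
  ∀ c : ℝ, 0 < c → ∀ x : Rd d, x ≠ 0 → φ (powAct c E x) = c * φ x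

section RandomMeasure

variable {d : ℕ} {Ω : Type*} [MeasurableSpace Ω]

/-- `W` is a complex isotropic symmetric `α`-stable random measure on `ℝ^d` with Lebesgue control
measure, on the probability space `(Ω, P)`.  Only the values `W A` for Borel sets `A` of finite
Lebesgue measure matter.  The number `κ > 0` is the normalizing constant of the characteristic
function (conventions in the literature differ here):
`𝔼 exp (i Re (z̄ W(A))) = exp (-κ |A| |z|^α)`, which is the rotationally invariant complex
symmetric `α`-stable law.  (`inner ℝ w z = Re (z̄ w)` on `ℂ` is the pairing in `charFun`.)

The series in the `σ`-additivity is an ordinary (in general only conditionally) convergent series,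
the exceptional null set may depend on the sequence of sets. -/
structure IsIsotropicStableMeasure (α κ : ℝ) (P : Measure Ω) (W : Set (Rd d) → Ω → ℂ) : Prop where
  measurable : ∀ A : Set (Rd d), MeasurableSet A → volume A < ∞ → Measurable (W A)
  charFun_eq : ∀ A : Set (Rd d), MeasurableSet A → volume A < ∞ → ∀ z : ℂ,
    charFun (P.map (W A)) z = Complex.exp ((-(κ * (volume A).toReal * ‖z‖ ^ α) : ℝ) : ℂ)
  indep : ∀ (n : ℕ) (A : Fin n → Set (Rd d)), (∀ i, MeasurableSet (A i)) →
    (∀ i, volume (A i) < ∞) → Pairwise (fun i j => Disjoint (A i) (A j)) →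
    iIndepFun (fun i => W (A i)) P
  sigma_additive : ∀ A : ℕ → Set (Rd d), (∀ i, MeasurableSet (A i)) →
    Pairwise (fun i j => Disjoint (A i) (A j)) → volume (⋃ i, A i) < ∞ →
    ∀ᵐ ω ∂P, Tendsto (fun n => ∑ i ∈ Finset.range n, W (A i) ω) atTop (𝓝 (W (⋃ i, A i) ω))

/-- The random integral of a simple function `g`, namely `∑ y · W(g = y)` over the values `y` of
`g`.  (The value `y = 0` contributes nothing.) -/
noncomputable def simpleIntegral (W : Set (Rd d) → Ω → ℂ) (g : SimpleFunc (Rd d) ℂ) (ω : Ω) : ℂ :=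
  ∑ y ∈ g.range, y * W (g ⁻¹' {y}) ω

/-- The random variable `Y` is (a version of) the random integral `∫ f(ξ) W(dξ)`: the function `f`
is in `L^α(ℝ^d, dξ)`, and for every sequence of simple functions with support of finite measure
which converges to `f` in `L^α`, the integrals of the simple functions converge to `Y` in
probability. -/
structure IsStableIntegral (α : ℝ) (P : Measure Ω) (W : Set (Rd d) → Ω → ℂ) (f : Rd d → ℂ)
    (Y : Ω → ℂ) : Prop where
  measurable : Measurable Y
  memLp : MemLp f (ENNReal.ofReal α) volume
  tendsto : ∀ g : ℕ → SimpleFunc (Rd d) ℂ, (∀ n, (g n).FinMeasSupp volume) →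
    Tendsto (fun n => eLpNorm (fun ξ => g n ξ - f ξ) (ENNReal.ofReal α) volume) atTop (𝓝 0) →
    TendstoInMeasure P (fun n => simpleIntegral W (g n)) atTop Y

/-- The integrand `(e^{i⟨x,ξ⟩} - 1) ψ(ξ)^{-H-q/α}` with `q = trace E`, as a function of `ξ`. -/
noncomputable def harmonizableKernel (E : Matrix (Fin d) (Fin d) ℝ) (α H : ℝ) (ψ : Rd d → ℝ)
    (x ξ : Rd d) : ℂ :=
  (Complex.exp (Complex.I * ((inner ℝ x ξ : ℝ) : ℂ)) - 1) *
    ((ψ ξ ^ (-H - E.trace / α) : ℝ) : ℂ)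

/-- `X` is (a version of) the harmonizable field
`X_ψ(x) = Re ∫ (e^{i⟨x,ξ⟩} - 1) ψ(ξ)^{-H-q/α} W(dξ)`, `x ∈ ℝ^d`. -/
def IsHarmonizableField (E : Matrix (Fin d) (Fin d) ℝ) (α H : ℝ) (ψ : Rd d → ℝ)
    (P : Measure Ω) (W : Set (Rd d) → Ω → ℂ) (X : Rd d → Ω → ℝ) : Prop :=
  ∀ x : Rd d, ∃ Y : Ω → ℂ,
    IsStableIntegral α P W (harmonizableKernel E α H ψ x) Y ∧ X x =ᵐ[P] fun ω => (Y ω).re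

/-- Equality of all finite-dimensional marginal distributions of two real random fields. -/
def FDDEq (P : Measure Ω) (X Y : Rd d → Ω → ℝ) : Prop :=
  ∀ (m : ℕ) (x : Fin m → Rd d),
    IdentDistrib (fun ω (j : Fin m) => X (x j) ω) (fun ω (j : Fin m) => Y (x j) ω) P P

/-- `{X(c^E x)}` and `{c^H X(x)}` have the same finite-dimensional distributions for all `c > 0`. -/
def IsOperatorScaling (P : Measure Ω) (E : Matrix (Fin d) (Fin d) ℝ) (H : ℝ)
    (X : Rd d → Ω → ℝ) : Prop :=
  ∀ c : ℝ, 0 < c → FDDEq P (fun x => X (powAct c E x)) (fun x ω => c ^ H * X x ω)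

/-- `{X(x+h) - X(h)}` and `{X(x)}` have the same finite-dimensional distributions for all `h`. -/
def HasStationaryIncrements (P : Measure Ω) (X : Rd d → Ω → ℝ) : Prop :=
  ∀ h : Rd d, FDDEq P (fun x ω => X (x + h) ω - X h ω) X

end RandomMeasure

end OperatorScaling

/-! Everything rests on one formula: for stable integrals `Y i` of `f i` and real `c i`, the
characteristic function of `∑ c i * Re (Y i)` at 1 is `exp (-κ ∫ |∑ c i f i|^α)`. On simple
functions it is independence over disjoint level sets (`charFun_simpleIntegral`); it passes to
limits in `integral_exp_sum_isStableIntegral`. By Cramér–Wold, an equality of finite-dimensional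
laws thus becomes an identity between integrals of `|∑ t i k_{x i}|^α`, where `k_x` is the kernel.

Scaling: `k_{c^E x}(ξ) = c^{H+q/α} k_x(c^{E^t} ξ)`, and the substitution `η = c^{E^t} ξ` has
Jacobian `c^q`, so the net factor is `c^{Hα}`. Stationarity: `k_{x+h} - k_h = e^{i⟨h,ξ⟩} k_x`, and
the unimodular factor does not change the modulus.

Existence needs `k_x ∈ L^α` (`memLp_harmonizableKernel`). Split space into dyadic annuli `ψ ≈ c`, of
volume proportional to `c^q`. There `ψ^{-Hα-q}` integrates to order `c^{-Hα}`, which is summable as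
`c → ∞`. As `c = 2^{-k} → 0`, the factor `|e^{i⟨x,ξ⟩} - 1| ≤ |x||ξ|` compensates: `|ξ| ≤ C r^k` with
`r < 2^{-H}`, which is where `H < a_1` enters. The integral itself exists because the tail bound
from the characteristic function makes it continuous from `L^α` to convergence in probability. -/

namespace OperatorScaling

/-! ### Finite additivity and the integral of simple functions -/

namespace IsIsotropicStableMeasure

variable {d : ℕ} {Ω : Type*} [MeasurableSpace Ω] {α κ : ℝ} {P : Measure Ω}
  {W : Set (Rd d) → Ω → ℂ}

/-- For the constant sequence `∅` the partial sums `n · W ∅` converge, so their increments `W ∅`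
tend to zero. -/
lemma empty_ae_eq (hW : IsIsotropicStableMeasure α κ P W) : ∀ᵐ ω ∂P, W ∅ ω = 0 := by
  have h := hW.sigma_additive (fun _ => ∅) (fun _ => .empty) (fun _ _ _ => disjoint_bot_left)
    (by simp)
  filter_upwards [h] with ω hω
  simp only [Set.iUnion_empty, Finset.sum_const, Finset.card_range] at hω
  have h2 := ((tendsto_add_atTop_iff_nat 1).2 hω).sub hω
  simp only [add_smul, one_smul, add_sub_cancel_left, sub_self] at h2
  exact tendsto_nhds_unique tendsto_const_nhds h2

lemma union_ae_eq (hW : IsIsotropicStableMeasure α κ P W) {A B : Set (Rd d)}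
    (hA : MeasurableSet A) (hB : MeasurableSet B) (hA' : volume A < ∞) (hB' : volume B < ∞)
    (hAB : Disjoint A B) : ∀ᵐ ω ∂P, W (A ∪ B) ω = W A ω + W B ω := by
  let S : ℕ → Set (Rd d) := fun n => if n = 0 then A else if n = 1 then B else ∅
  have hU : (⋃ i, S i) = A ∪ B := by
    ext x
    simp only [S, Set.mem_iUnion, Set.mem_union]
    constructor
    · rintro ⟨i, hi⟩
      split_ifs at hi
      · exact .inl hi
      · exact .inr hi
      · exact hi.elim
    · rintro (h | h)
      · exact ⟨0, by simpa using h⟩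
      · exact ⟨1, by simpa using h⟩
  have h := hW.sigma_additive S
    (fun i => by dsimp only [S]; split_ifs <;> simp [*])
    (fun i j hij => by
      dsimp only [S]
      split_ifs <;> first | omega | simp [hAB.symm])
    (by rw [hU]; exact (measure_union_le _ _).trans_lt (ENNReal.add_lt_top.2 ⟨hA', hB'⟩))
  filter_upwards [h, hW.empty_ae_eq] with ω hω h0
  rw [hU] at hω
  refine tendsto_nhds_unique hω (tendsto_const_nhds.congr' ?_)
  filter_upwards [eventually_ge_atTop 2] with n hn
  obtain ⟨k, rfl⟩ := Nat.exists_eq_add_of_le' hn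
  rw [Finset.sum_range_succ', Finset.sum_range_succ']
  simp [S, h0, add_comm]

lemma preimage_finset_ae_eq (hW : IsIsotropicStableMeasure α κ P W) {β : Type*}
    (p : SimpleFunc (Rd d) β) (s : Finset β) (hs : ∀ b ∈ s, volume (p ⁻¹' {b}) < ∞) :
    ∀ᵐ ω ∂P, W (p ⁻¹' ↑s) ω = ∑ b ∈ s, W (p ⁻¹' {b}) ω := by
  classical
  induction s using Finset.induction_on with
  | empty => simpa using hW.empty_ae_eq
  | insert a s ha ih =>
    have hfin : volume (p ⁻¹' (s : Set β)) < ∞ := by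
      rw [← SimpleFunc.sum_measure_preimage_singleton]
      exact ENNReal.sum_lt_top.2 fun b hb => hs b (Finset.mem_insert_of_mem hb)
    filter_upwards [ih fun b hb => hs b (Finset.mem_insert_of_mem hb),
      hW.union_ae_eq (p.measurableSet_preimage {a}) (p.measurableSet_preimage ↑s)
        (hs a (Finset.mem_insert_self _ _)) hfin
        (Disjoint.preimage _ (by simpa using ha))] with ω h1 h2
    rw [Finset.sum_insert ha, ← h1, ← h2, Finset.coe_insert, Set.insert_eq, Set.preimage_union]

/-- Allows computing the integral on a partition finer than the level sets: cells on which `φ` takes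
the same value merge by finite additivity. A cell of infinite measure must carry the coefficient
zero, so the unknown value of `W` there is harmless. -/
lemma simpleIntegral_map_ae_eq (hW : IsIsotropicStableMeasure α κ P W) {β : Type*}
    (p : SimpleFunc (Rd d) β) (φ : β → ℂ) (hφ : ∀ b, φ b ≠ 0 → volume (p ⁻¹' {b}) < ∞) :
    simpleIntegral W (p.map φ) =ᵐ[P] fun ω => ∑ b ∈ p.range, φ b * W (p ⁻¹' {b}) ω := by
  classical
  have h : ∀ y : ℂ, ∀ᵐ ω ∂P, y * W ((p.map φ) ⁻¹' {y}) ω =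
      ∑ b ∈ p.range with φ b = y, φ b * W (p ⁻¹' {b}) ω := by
    intro y
    rcases eq_or_ne y 0 with rfl | hy
    · refine ae_of_all _ fun ω => ?_
      rw [zero_mul, eq_comm]
      refine Finset.sum_eq_zero fun b hb => ?_
      rw [(Finset.mem_filter.1 hb).2, zero_mul]
    · have := hW.preimage_finset_ae_eq p (p.range.filter fun b => φ b = y) (fun b hb => hφ b (by
        rw [(Finset.mem_filter.1 hb).2]; exact hy))
      filter_upwards [this] with ω hω
      rw [SimpleFunc.map_preimage_singleton, hω, Finset.mul_sum]
      exact Finset.sum_congr rfl fun b hb => by rw [(Finset.mem_filter.1 hb).2]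
  have h' := (ae_ball_iff (p.map φ).range.countable_toSet).2 fun y _ => h y
  filter_upwards [h'] with ω hω
  rw [simpleIntegral, Finset.sum_congr rfl fun y hy => hω y hy]
  rw [SimpleFunc.range_map]
  exact Finset.sum_fiberwise_of_maps_to (fun b hb => Finset.mem_image_of_mem φ hb) _

lemma simpleIntegral_add (hW : IsIsotropicStableMeasure α κ P W) {g h : SimpleFunc (Rd d) ℂ}
    (hg : g.FinMeasSupp volume) (hh : h.FinMeasSupp volume) :
    simpleIntegral W (g + h) =ᵐ[P] fun ω => simpleIntegral W g ω + simpleIntegral W h ω := by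
  -- The level sets of the pair `(g, h)` are a common refinement on which all three integrals are
  -- finite sums over the same index set.
  have hp : ∀ b : ℂ × ℂ, b ≠ 0 → volume (g.pair h ⁻¹' {b}) < ∞ := fun b hb =>
    (hg.pair hh).meas_preimage_singleton_ne_zero hb
  have h1 := hW.simpleIntegral_map_ae_eq (g.pair h) (fun b => b.1 + b.2)
    (fun b hb => hp b (by rintro rfl; simp at hb))
  have h2 := hW.simpleIntegral_map_ae_eq (g.pair h) Prod.fst
    (fun b hb => hp b (by rintro rfl; simp at hb))
  have h3 := hW.simpleIntegral_map_ae_eq (g.pair h) Prod.snd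
    (fun b hb => hp b (by rintro rfl; simp at hb))
  rw [SimpleFunc.map_fst_pair] at h2
  rw [SimpleFunc.map_snd_pair] at h3
  rw [← SimpleFunc.add_eq_map₂] at h1
  filter_upwards [h1, h2, h3] with ω h1 h2 h3
  rw [h1, h2, h3, ← Finset.sum_add_distrib]
  exact Finset.sum_congr rfl fun b _ => by ring

lemma simpleIntegral_smul (hW : IsIsotropicStableMeasure α κ P W) {g : SimpleFunc (Rd d) ℂ}
    (hg : g.FinMeasSupp volume) (c : ℂ) :
    simpleIntegral W (c • g) =ᵐ[P] fun ω => c * simpleIntegral W g ω := by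
  have h1 := hW.simpleIntegral_map_ae_eq g (fun b => c • b)
    (fun b hb => hg.meas_preimage_singleton_ne_zero (by rintro rfl; simp at hb))
  rw [← SimpleFunc.smul_eq_map] at h1
  filter_upwards [h1] with ω h1
  rw [h1, simpleIntegral, Finset.mul_sum]
  exact Finset.sum_congr rfl fun b _ => by rw [smul_eq_mul, mul_assoc]

lemma _root_.OperatorScaling.finMeasSupp_smul {g : SimpleFunc (Rd d) ℂ}
    (hg : g.FinMeasSupp volume) (c : ℂ) : (c • g).FinMeasSupp volume := by
  rw [SimpleFunc.smul_eq_map]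
  exact hg.map (smul_zero c)

lemma _root_.OperatorScaling.finMeasSupp_sum {ι : Type*} (s : Finset ι)
    {g : ι → SimpleFunc (Rd d) ℂ} (hg : ∀ i ∈ s, (g i).FinMeasSupp volume) :
    (∑ i ∈ s, g i).FinMeasSupp volume := by
  classical
  induction s using Finset.induction_on with
  | empty => simp [SimpleFunc.finMeasSupp_iff_support]
  | insert a s ha ih =>
    rw [Finset.sum_insert ha]
    exact (hg a (Finset.mem_insert_self _ _)).add (ih fun i hi => hg i (Finset.mem_insert_of_mem hi))

lemma simpleIntegral_sum (hW : IsIsotropicStableMeasure α κ P W) {ι : Type*} (s : Finset ι)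
    {g : ι → SimpleFunc (Rd d) ℂ} (hg : ∀ i, (g i).FinMeasSupp volume) (c : ι → ℂ) :
    simpleIntegral W (∑ i ∈ s, c i • g i) =ᵐ[P] fun ω => ∑ i ∈ s, c i * simpleIntegral W (g i) ω := by
  classical
  induction s using Finset.induction_on with
  | empty =>
    refine ae_of_all _ fun ω => ?_
    simp only [Finset.sum_empty, simpleIntegral]
    refine Finset.sum_eq_zero fun y hy => ?_
    obtain ⟨x, hx⟩ := SimpleFunc.mem_range.1 hy
    simp [← hx]
  | insert a s ha ih =>
    rw [Finset.sum_insert ha]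
    filter_upwards [ih, hW.simpleIntegral_smul (hg a) (c a),
      hW.simpleIntegral_add (finMeasSupp_smul (hg a) (c a))
        (finMeasSupp_sum s fun i _ => finMeasSupp_smul (hg i) (c i))] with ω h1 h2 h3
    rw [h3, h2, h1, Finset.sum_insert ha]

lemma measurable_simpleIntegral (hW : IsIsotropicStableMeasure α κ P W)
    {g : SimpleFunc (Rd d) ℂ} (hg : g.FinMeasSupp volume) : Measurable (simpleIntegral W g) := by
  unfold simpleIntegral
  refine Finset.measurable_fun_sum _ fun y _ => ?_
  rcases eq_or_ne y 0 with rfl | hy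
  · simp
  · exact (hW.measurable _ (g.measurableSet_preimage _)
      (hg.meas_preimage_singleton_ne_zero hy)).const_mul y

lemma charFun_const_mul_eq [IsProbabilityMeasure P] (hW : IsIsotropicStableMeasure α κ P W)
    {A : Set (Rd d)} (hA : MeasurableSet A) (hA' : volume A < ∞) (y z : ℂ) :
    charFun (P.map fun ω => y * W A ω) z =
      Complex.exp ((-(κ * (volume A).toReal * (‖y‖ * ‖z‖) ^ α) : ℝ) : ℂ) := by
  have hm := hW.measurable A hA hA'
  have h := hW.charFun_eq A hA hA' ((starRingEnd ℂ) y * z)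
  rw [norm_mul, RCLike.norm_conj] at h
  rw [← h, charFun_apply, charFun_apply, integral_map (hm.const_mul y).aemeasurable (by fun_prop),
    integral_map hm.aemeasurable (by fun_prop)]
  congr with ω
  congr 3
  simp [Complex.inner]
  ring

/-- The level sets are disjoint, so the summands are independent and the exponents add up to the
integral of `|g|^α`; by isotropy only the moduli of the coefficients matter. -/
lemma charFun_simpleIntegral [IsProbabilityMeasure P] (hW : IsIsotropicStableMeasure α κ P W)
    (hα : 0 < α) {g : SimpleFunc (Rd d) ℂ} (hg : g.FinMeasSupp volume) (z : ℂ) :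
    charFun (P.map (simpleIntegral W g)) z =
      Complex.exp ((-(κ * (∫⁻ ξ, ‖g ξ‖ₑ ^ α).toReal * ‖z‖ ^ α) : ℝ) : ℂ) := by
  classical
  -- The level set of 0 has infinite measure in general, and nothing is known about `W` there.
  set s : Finset ℂ := g.range.erase 0 with hs
  have hs0 : ∀ y : s, (y : ℂ) ≠ 0 := fun y => (Finset.mem_erase.1 y.2).1
  have hfin : ∀ y : s, volume (g ⁻¹' {(y : ℂ)}) < ∞ := fun y =>
    hg.meas_preimage_singleton_ne_zero (hs0 y)
  have hsum : simpleIntegral W g = fun ω => ∑ y : s, (y : ℂ) * W (g ⁻¹' {(y : ℂ)}) ω := by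
    ext ω
    rw [Finset.sum_coe_sort s fun y => y * W (g ⁻¹' {y}) ω, simpleIntegral, hs,
      Finset.sum_erase _ (by simp)]
  have hind : iIndepFun (fun y : s => W (g ⁻¹' {(y : ℂ)})) P := by
    have e := s.equivFin
    have := hW.indep s.card (fun i => g ⁻¹' {((e.symm i : s) : ℂ)})
      (fun i => g.measurableSet_preimage _) (fun i => hfin _)
      (fun i j hij => Disjoint.preimage _ (by
        simpa [Subtype.coe_injective.eq_iff] using hij))
    simpa using this.precomp e.injective
  have hind' : iIndepFun (fun (y : s) ω => (y : ℂ) * W (g ⁻¹' {(y : ℂ)}) ω) P :=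
    hind.comp (fun y w => (y : ℂ) * w) fun y => measurable_const_mul _
  rw [hsum, iIndepFun.charFun_map_fun_sum_eq_prod (fun y => ((hW.measurable _
    (g.measurableSet_preimage _) (hfin y)).const_mul _).aemeasurable) hind', Finset.prod_apply]
  simp_rw [hW.charFun_const_mul_eq (g.measurableSet_preimage _) (hfin _)]
  rw [← Complex.exp_sum, ← Complex.ofReal_sum]
  congr 2
  have hI : ∫⁻ ξ, ‖g ξ‖ₑ ^ α = ∑ y : s, ‖(y : ℂ)‖ₑ ^ α * volume (g ⁻¹' {(y : ℂ)}) := by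
    rw [Finset.sum_coe_sort s fun y => ‖y‖ₑ ^ α * volume (g ⁻¹' {y}), hs,
      Finset.sum_erase _ (by simp [hα]), ← SimpleFunc.map_lintegral (fun y : ℂ => ‖y‖ₑ ^ α),
      ← SimpleFunc.lintegral_eq_lintegral]
    rfl
  rw [hI, ENNReal.toReal_sum fun y _ => ENNReal.mul_ne_top (by simp [hα.le]) (hfin y).ne,
    Finset.mul_sum, Finset.sum_mul, ← Finset.sum_neg_distrib]
  refine Finset.sum_congr rfl fun y _ => ?_
  rw [ENNReal.toReal_mul, ← ENNReal.toReal_rpow, toReal_enorm,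
    Real.mul_rpow (norm_nonneg _) (norm_nonneg _)]
  ring

end IsIsotropicStableMeasure

end OperatorScaling

/-! ### Extension of the integral from simple functions to `L^α` -/

namespace OperatorScaling

/-- Bounding the sum by twice the maximum works for every `α > 0`, so `α < 1` needs no separate
treatment. -/
lemma enorm_sub_rpow_le {α : ℝ} (hα : 0 < α) (a b c : ℂ) :
    ‖a - b‖ₑ ^ α ≤ 2 ^ α * (‖a - c‖ₑ ^ α + ‖b - c‖ₑ ^ α) := by
  have h1 : ‖a - b‖ₑ ≤ 2 * max ‖a - c‖ₑ ‖b - c‖ₑ := by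
    calc ‖a - b‖ₑ = ‖(a - c) - (b - c)‖ₑ := by congr 1; ring
      _ ≤ ‖a - c‖ₑ + ‖b - c‖ₑ := enorm_sub_le
      _ ≤ _ := by rw [two_mul]; exact add_le_add (le_max_left _ _) (le_max_right _ _)
  calc ‖a - b‖ₑ ^ α ≤ (2 * max ‖a - c‖ₑ ‖b - c‖ₑ) ^ α := ENNReal.rpow_le_rpow h1 hα.le
    _ = 2 ^ α * max ‖a - c‖ₑ ‖b - c‖ₑ ^ α := ENNReal.mul_rpow_of_nonneg _ _ hα.le
    _ ≤ _ := by
      gcongr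
      rcases max_choice ‖a - c‖ₑ ‖b - c‖ₑ with h | h <;> rw [h]
      · exact le_self_add
      · exact le_add_self

lemma tendsto_lintegral_rpow_of_eLpNorm {X ι : Type*} [MeasurableSpace X] {μ : Measure X} {α : ℝ}
    (hα : 0 < α) {l : Filter ι} {u : ι → X → ℂ}
    (h : Tendsto (fun i => eLpNorm (u i) (ENNReal.ofReal α) μ) l (𝓝 0)) :
    Tendsto (fun i => ∫⁻ x, ‖u i x‖ₑ ^ α ∂μ) l (𝓝 0) := by
  have h2 := (ENNReal.continuous_rpow_const (y := α)).continuousAt.tendsto.comp h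
  rw [ENNReal.zero_rpow_of_pos hα] at h2
  refine h2.congr fun i => ?_
  rw [Function.comp_apply, eLpNorm_eq_lintegral_rpow_enorm_toReal (by simpa using hα) (by simp),
    ENNReal.toReal_ofReal hα.le, ← ENNReal.rpow_mul, one_div_mul_cancel hα.ne', ENNReal.rpow_one]

lemma tendsto_lintegral_sub_rpow {X ι : Type*} [MeasurableSpace X] {μ : Measure X} {α : ℝ}
    (hα : 0 < α) {l : Filter ι} {u v : ι → X → ℂ} {f : X → ℂ} (hu : ∀ i, Measurable (u i))
    (hf : Measurable f)
    (h1 : Tendsto (fun i => ∫⁻ x, ‖u i x - f x‖ₑ ^ α ∂μ) l (𝓝 0))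
    (h2 : Tendsto (fun i => ∫⁻ x, ‖v i x - f x‖ₑ ^ α ∂μ) l (𝓝 0)) :
    Tendsto (fun i => ∫⁻ x, ‖u i x - v i x‖ₑ ^ α ∂μ) l (𝓝 0) := by
  have h3 := ENNReal.Tendsto.const_mul (a := (2 : ℝ≥0∞) ^ α) (h1.add h2) (.inr (by simp))
  rw [add_zero, mul_zero] at h3
  refine tendsto_of_tendsto_of_tendsto_of_le_of_le tendsto_const_nhds h3 (fun _ => zero_le) ?_
  intro i
  dsimp only
  have hm : Measurable fun x => ‖u i x - f x‖ₑ ^ α := ((hu i).sub hf).enorm.pow_const α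
  rw [← lintegral_add_left hm, ← lintegral_const_mul' _ _ (by simp)]
  exact lintegral_mono fun x => enorm_sub_rpow_le hα _ _ _

/-- Completeness of convergence in probability: Borel–Cantelli along a subsequence whose consecutive
differences exceed `2^{-n}` with probability at most `2^{-n}`. -/
lemma exists_seq_tendsto_ae_of_cauchy {Ω : Type*} [MeasurableSpace Ω] {P : Measure Ω}
    {f : ℕ → Ω → ℂ} (hf : ∀ n, Measurable (f n))
    (h : ∀ ε : ℝ, 0 < ε →
      Tendsto (fun p : ℕ × ℕ => P {ω | ε ≤ ‖f p.1 ω - f p.2 ω‖}) atTop (𝓝 0)) :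
    ∃ ns : ℕ → ℕ, StrictMono ns ∧ ∃ Y : Ω → ℂ, Measurable Y ∧
      ∀ᵐ ω ∂P, Tendsto (fun n => f (ns n) ω) atTop (𝓝 (Y ω)) := by
  have h2 : ∀ n : ℕ, ∃ N, ∀ k ≥ N, ∀ j ≥ k,
      P {ω | (1 / 2 : ℝ) ^ n ≤ ‖f k ω - f j ω‖} ≤ (1 / 2 : ℝ≥0∞) ^ n := by
    intro n
    have := (h ((1 / 2) ^ n) (by positivity)).eventually_le_const
      (u := (1 / 2 : ℝ≥0∞) ^ n) (ENNReal.pow_pos (by simp) n)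
    obtain ⟨⟨a, b⟩, hab⟩ := eventually_atTop.1 this
    exact ⟨max a b, fun k hk j hj => hab (k, j)
      ⟨(le_max_left _ _).trans hk, (le_max_right _ _).trans (hk.trans hj)⟩⟩
  obtain ⟨ns, hns, hP⟩ := extraction_forall_of_eventually' h2
  refine ⟨ns, hns, ?_⟩
  have hsum : ∑' n, P {ω | (1 / 2 : ℝ) ^ n ≤ ‖f (ns n) ω - f (ns (n + 1)) ω‖} ≠ ∞ := by
    refine ne_top_of_le_ne_top ?_ (ENNReal.tsum_le_tsum fun n => hP n _ (hns.monotone n.le_succ))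
    rw [ENNReal.tsum_geometric]
    simp
  refine measurable_limit_of_tendsto_metrizable_ae (fun n => (hf (ns n)).aemeasurable) ?_
  filter_upwards [ae_eventually_notMem hsum] with ω hω
  refine cauchySeq_tendsto_of_complete (cauchySeq_of_summable_dist ?_)
  refine Summable.of_norm_bounded_eventually_nat (g := fun n => (1 / 2 : ℝ) ^ n)
    summable_geometric_two ?_
  filter_upwards [hω] with n hn
  rw [Real.norm_of_nonneg dist_nonneg, dist_eq_norm]
  exact (not_le.1 hn).le

lemma simpleFunc_sum_apply {X ι : Type*} [MeasurableSpace X] (s : Finset ι)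
    (g : ι → SimpleFunc X ℂ) (x : X) : (∑ i ∈ s, g i) x = ∑ i ∈ s, g i x := by
  classical
  induction s using Finset.induction_on with
  | empty => simp
  | insert a s ha ih => rw [Finset.sum_insert ha, Finset.sum_insert ha, SimpleFunc.coe_add,
      Pi.add_apply, ih]

namespace IsIsotropicStableMeasure

variable {d : ℕ} {Ω : Type*} [MeasurableSpace Ω] {α κ : ℝ} {P : Measure Ω}
  {W : Set (Rd d) → Ω → ℂ} [IsProbabilityMeasure P]

/-- The truncation inequality bounds the tail by an average of `1 - charFun` over `|t| ≤ 2/r`, and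
`1 - e^{-s} ≤ s` makes it linear in the integral of `|g|^α`. -/
lemma measureReal_inner_simpleIntegral_gt_le (hW : IsIsotropicStableMeasure α κ P W)
    (hα : 0 < α) (hκ : 0 < κ) {g : SimpleFunc (Rd d) ℂ} (hg : g.FinMeasSupp volume) {a : ℂ}
    (ha : ‖a‖ = 1) {r : ℝ} (hr : 0 < r) :
    P.real {ω | r < |inner ℝ a (simpleIntegral W g ω)|} ≤
      2 * κ * (2 * r⁻¹) ^ α * (∫⁻ ξ, ‖g ξ‖ₑ ^ α).toReal := by
  have hm := hW.measurable_simpleIntegral hg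
  have : IsProbabilityMeasure (P.map (simpleIntegral W g)) :=
    Measure.isProbabilityMeasure_map hm.aemeasurable
  have h := measureReal_abs_inner_gt_le_integral_charFun
    (μ := P.map (simpleIntegral W g)) (a := a) hr
  have hms : MeasurableSet {x : ℂ | r < |inner ℝ a x|} :=
    measurableSet_lt measurable_const (by fun_prop)
  rw [map_measureReal_apply hm hms] at h
  set J := (∫⁻ ξ, ‖g ξ‖ₑ ^ α).toReal with hJ
  have hJ0 : 0 ≤ J := ENNReal.toReal_nonneg
  have hb : ∀ t ∈ Set.uIoc (-2 * r⁻¹) (2 * r⁻¹),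
      ‖1 - charFun (P.map (simpleIntegral W g)) (t • a)‖ ≤ κ * J * (2 * r⁻¹) ^ α := by
    intro t ht
    have hr' : 0 < r⁻¹ := inv_pos.2 hr
    rw [Set.uIoc_of_le (by linarith)] at ht
    have htabs : |t| ≤ 2 * r⁻¹ := abs_le.2 ⟨by linarith [ht.1], ht.2⟩
    rw [hW.charFun_simpleIntegral hα hg, norm_smul, ha, mul_one, Real.norm_eq_abs, ← hJ,
      ← Complex.ofReal_exp, ← Complex.ofReal_one, ← Complex.ofReal_sub, Complex.norm_real,
      Real.norm_eq_abs]
    have h0 : 0 ≤ κ * J * |t| ^ α := by positivity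
    have h1 : κ * J * |t| ^ α ≤ κ * J * (2 * r⁻¹) ^ α := by gcongr
    have h2 : Real.exp (-(κ * J * |t| ^ α)) ≤ 1 := Real.exp_le_one_iff.2 (by linarith)
    rw [abs_of_nonneg (by linarith)]
    linarith [Real.add_one_le_exp (-(κ * J * |t| ^ α))]
  have h3 := intervalIntegral.norm_integral_le_of_norm_le_const hb
  have hr' : 0 < r⁻¹ := inv_pos.2 hr
  rw [show 2 * r⁻¹ - -2 * r⁻¹ = 4 * r⁻¹ by ring, abs_of_pos (by positivity)] at h3
  calc _ ≤ _ := h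
    _ ≤ 2⁻¹ * r * (κ * J * (2 * r⁻¹) ^ α * (4 * r⁻¹)) := by gcongr
    _ = _ := by field_simp; ring

lemma measureReal_norm_sub_ge_le (hW : IsIsotropicStableMeasure α κ P W)
    (hα : 0 < α) (hκ : 0 < κ) {g h : SimpleFunc (Rd d) ℂ} (hg : g.FinMeasSupp volume)
    (hh : h.FinMeasSupp volume) {ε : ℝ} (hε : 0 < ε) :
    P.real {ω | ε ≤ ‖simpleIntegral W g ω - simpleIntegral W h ω‖} ≤
      4 * κ * (2 * (ε / 3)⁻¹) ^ α * (∫⁻ ξ, ‖g ξ - h ξ‖ₑ ^ α).toReal := by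
  set u : SimpleFunc (Rd d) ℂ := g + (-1 : ℂ) • h with hu
  have hu' : u.FinMeasSupp volume := hg.add (finMeasSupp_smul hh _)
  have hval : ∀ ξ, g ξ - h ξ = u ξ := fun ξ => by simp [hu, sub_eq_add_neg]
  have hsub : ∀ᵐ ω ∂P, simpleIntegral W g ω - simpleIntegral W h ω = simpleIntegral W u ω := by
    filter_upwards [hW.simpleIntegral_add hg (finMeasSupp_smul hh (-1)),
      hW.simpleIntegral_smul hh (-1)] with ω h1 h2
    rw [h1, h2]; ring
  -- The modulus is at most `|Re| + |Im|`. The threshold `ε / 3` leaves strict room, since the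
  -- complements of the two events only give non-strict bounds.
  have hset : {ω | ε ≤ ‖simpleIntegral W g ω - simpleIntegral W h ω‖} ≤ᵐ[P]
      ({ω | ε / 3 < |inner ℝ (1 : ℂ) (simpleIntegral W u ω)|} ∪
        {ω | ε / 3 < |inner ℝ Complex.I (simpleIntegral W u ω)|} : Set Ω) := by
    filter_upwards [hsub] with ω hω hmem
    change ε ≤ _ at hmem
    rw [hω] at hmem
    change _ ∨ _
    by_contra hcon
    rw [not_or] at hcon
    obtain ⟨h1, h2⟩ := hcon
    simp only [Set.mem_ofPred_eq, not_lt, Complex.inner] at h1 h2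
    have := Complex.norm_le_abs_re_add_abs_im (simpleIntegral W u ω)
    simp at h1 h2
    linarith
  simp_rw [hval]
  calc _ ≤ _ := ENNReal.toReal_mono (measure_ne_top _ _) (measure_mono_ae hset)
    _ ≤ _ := measureReal_union_le _ _
    _ ≤ _ := add_le_add
      (hW.measureReal_inner_simpleIntegral_gt_le hα hκ hu' (by simp) (by positivity))
      (hW.measureReal_inner_simpleIntegral_gt_le hα hκ hu' (by simp) (by positivity))
    _ = _ := by ring

lemma tendsto_measure_norm_sub_ge (hW : IsIsotropicStableMeasure α κ P W)
    (hα : 0 < α) (hκ : 0 < κ) {ι : Type*} {l : Filter ι} {g h : ι → SimpleFunc (Rd d) ℂ}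
    (hg : ∀ i, (g i).FinMeasSupp volume) (hh : ∀ i, (h i).FinMeasSupp volume)
    (hgh : Tendsto (fun i => ∫⁻ ξ, ‖g i ξ - h i ξ‖ₑ ^ α) l (𝓝 0)) {ε : ℝ} (hε : 0 < ε) :
    Tendsto (fun i => P {ω | ε ≤ ‖simpleIntegral W (g i) ω - simpleIntegral W (h i) ω‖}) l
      (𝓝 0) := by
  rw [← ENNReal.tendsto_toReal_iff (fun _ => measure_ne_top _ _) ENNReal.zero_ne_top]
  have h1 := ((ENNReal.tendsto_toReal ENNReal.zero_ne_top).comp hgh).const_mul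
    (4 * κ * (2 * (ε / 3)⁻¹) ^ α)
  rw [ENNReal.toReal_zero, mul_zero] at h1
  exact tendsto_of_tendsto_of_tendsto_of_le_of_le tendsto_const_nhds h1
    (fun _ => ENNReal.toReal_nonneg)
    (fun i => hW.measureReal_norm_sub_ge_le hα hκ (hg i) (hh i) hε)

/-- Simple functions of finite measure support converging to `f` pointwise, dominated by `2‖f‖`,
and in `L^α`. -/
lemma _root_.OperatorScaling.exists_simpleFunc_approx (hα : 0 < α) {f : Rd d → ℂ}
    (hf : Measurable f) (hfα : MemLp f (ENNReal.ofReal α) volume) :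
    ∃ g : ℕ → SimpleFunc (Rd d) ℂ, (∀ n, (g n).FinMeasSupp volume) ∧
      Tendsto (fun n => eLpNorm (fun ξ => g n ξ - f ξ) (ENNReal.ofReal α) volume) atTop (𝓝 0) ∧
      (∀ n ξ, ‖g n ξ‖ ≤ 2 * ‖f ξ‖) ∧ ∀ ξ, Tendsto (fun n => g n ξ) atTop (𝓝 (f ξ)) := by
  refine ⟨SimpleFunc.approxOn f hf Set.univ 0 (Set.mem_univ _), fun n => ?_, ?_, fun n ξ => ?_,
    fun ξ => ?_⟩
  · exact (SimpleFunc.memLp_iff_finMeasSupp (by simpa using hα) (by simp)).1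
      (SimpleFunc.memLp_approxOn hf hfα (Set.mem_univ _) MemLp.zero n)
  · exact SimpleFunc.tendsto_approxOn_Lp_eLpNorm hf (Set.mem_univ _) (by simp)
      (by simp) (by simpa using hfα.2)
  · rw [two_mul]
    exact SimpleFunc.norm_approxOn_zero_le hf (Set.mem_univ _) ξ n
  · exact SimpleFunc.tendsto_approxOn hf (Set.mem_univ _) (by simp)

/-- The limit is built from one approximating sequence; any other one stays close to it in `L^α`,
hence its integrals do so in probability. -/
lemma exists_isStableIntegral (hW : IsIsotropicStableMeasure α κ P W)
    (hα : 0 < α) (hκ : 0 < κ) {f : Rd d → ℂ}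
    (hf : Measurable f) (hfα : MemLp f (ENNReal.ofReal α) volume) :
    ∃ Y, IsStableIntegral α P W f Y := by
  obtain ⟨g, hg, hgf, -, -⟩ := exists_simpleFunc_approx hα hf hfα
  have hJ := tendsto_lintegral_rpow_of_eLpNorm hα hgf
  obtain ⟨ns, hns, Y, hY, hlim⟩ := exists_seq_tendsto_ae_of_cauchy (P := P)
    (f := fun n => simpleIntegral W (g n)) (fun n => hW.measurable_simpleIntegral (hg n))
    (fun ε hε => hW.tendsto_measure_norm_sub_ge hα hκ (l := atTop) (g := fun p : ℕ × ℕ => g p.1)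
      (h := fun p => g p.2) (fun p => hg _) (fun p => hg _)
      (tendsto_lintegral_sub_rpow hα (fun p => (g p.1).measurable) hf
        (hJ.comp (prod_atTop_atTop_eq (α := ℕ) (β := ℕ) ▸ tendsto_fst))
        (hJ.comp (prod_atTop_atTop_eq (α := ℕ) (β := ℕ) ▸ tendsto_snd))) hε)
  refine ⟨Y, hY, hfα, fun g' hg' hg'f => ?_⟩
  have hY' := tendstoInMeasure_of_tendsto_ae
    (fun n => (hW.measurable_simpleIntegral (hg (ns n))).aestronglyMeasurable) hlim
  rw [tendstoInMeasure_iff_norm] at hY' ⊢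
  intro ε hε
  have h1 := hW.tendsto_measure_norm_sub_ge hα hκ hg' (fun n => hg (ns n))
    (tendsto_lintegral_sub_rpow hα (fun n => (g' n).measurable) hf
      (tendsto_lintegral_rpow_of_eLpNorm hα hg'f) (hJ.comp hns.tendsto_atTop)) (half_pos hε)
  have h2 := h1.add (hY' (ε / 2) (half_pos hε))
  rw [add_zero] at h2
  refine tendsto_of_tendsto_of_tendsto_of_le_of_le tendsto_const_nhds h2 (fun _ => zero_le) ?_
  refine fun n => (measure_mono ?_).trans (measure_union_le _ _)
  intro ω hω
  by_contra hcon
  simp only [Set.mem_union, Set.mem_ofPred_eq, not_or, not_le] at hcon hω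
  have := norm_sub_le_norm_sub_add_norm_sub (simpleIntegral W (g' n) ω)
    (simpleIntegral W (g (ns n)) ω) (Y ω)
  linarith [hcon.1, hcon.2]

/-- The formula is known for simple functions by linearity. Both sides pass to the limit by
dominated convergence, with dominating function 1 on `Ω` and `(∑ 2|c i||f i|)^α` on `ℝ^d`. -/
lemma integral_exp_sum_isStableIntegral (hW : IsIsotropicStableMeasure α κ P W) (hα : 0 < α)
    {ι : Type*} [Fintype ι] {f : ι → Rd d → ℂ} {Y : ι → Ω → ℂ} (hf : ∀ i, Measurable (f i))
    (hY : ∀ i, IsStableIntegral α P W (f i) (Y i)) (c : ι → ℝ) :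
    ∫ ω, Complex.exp (((∑ i, c i * (Y i ω).re : ℝ) : ℂ) * Complex.I) ∂P =
      Complex.exp ((-(κ * (∫⁻ ξ, ‖∑ i, (c i : ℂ) * f i ξ‖ₑ ^ α).toReal) : ℝ) : ℂ) := by
  choose g hg hgf hdom hlim using fun i => exists_simpleFunc_approx hα (hf i) (hY i).memLp
  -- Convergence of the whole vector yields a single almost surely convergent subsequence for all
  -- indices at once.
  have hvec : TendstoInMeasure P (fun n ω i => simpleIntegral W (g i n) ω) atTop
      (fun ω i => Y i ω) := by
    intro ε hε
    have h1 : Tendsto (fun n => ∑ i, P {ω | ε ≤ edist (simpleIntegral W (g i n) ω) (Y i ω)})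
        atTop (𝓝 (∑ _i : ι, 0)) :=
      tendsto_finsetSum _ fun i _ => (hY i).tendsto (g i) (hg i) (hgf i) ε hε
    rw [Finset.sum_const_zero] at h1
    refine tendsto_of_tendsto_of_tendsto_of_le_of_le tendsto_const_nhds h1 (fun _ => zero_le) ?_
    refine fun n => (measure_mono ?_).trans (measure_biUnion_finset_le _ _)
    intro ω hω
    obtain ⟨i, hi, hle⟩ := (Finset.le_sup_iff hε).1 (show ε ≤ _ from hω)
    exact Set.mem_biUnion hi hle
  obtain ⟨ns, hns, hae⟩ := hvec.exists_seq_tendsto_ae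
  have hfin : ∀ n, (∑ i, (c i : ℂ) • g i n).FinMeasSupp volume := fun n =>
    finMeasSupp_sum _ fun i _ => finMeasSupp_smul (hg i n) _
  have hval : ∀ n ξ, (∑ i, (c i : ℂ) • g i n) ξ = ∑ i, (c i : ℂ) * g i n ξ := fun n ξ => by
    simp [simpleFunc_sum_apply]
  have hleft : ∀ n, ∫ ω, Complex.exp
      (((∑ i, c i * (simpleIntegral W (g i n) ω).re : ℝ) : ℂ) * Complex.I) ∂P =
      Complex.exp ((-(κ * (∫⁻ ξ, ‖∑ i, (c i : ℂ) * g i n ξ‖ₑ ^ α).toReal) : ℝ) : ℂ) := by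
    intro n
    have h := hW.charFun_simpleIntegral hα (hfin n) 1
    rw [norm_one, Real.one_rpow, mul_one, charFun_apply,
      integral_map (hW.measurable_simpleIntegral (hfin n)).aemeasurable (by fun_prop)] at h
    simp_rw [hval] at h
    rw [← h]
    refine integral_congr_ae ?_
    filter_upwards [hW.simpleIntegral_sum Finset.univ (fun i => hg i n) fun i => (c i : ℂ)] with ω hω
    rw [hω]
    congr 3
    simp [Complex.inner]
  have hlimL : Tendsto (fun n => ∫ ω, Complex.exp
      (((∑ i, c i * (simpleIntegral W (g i (ns n)) ω).re : ℝ) : ℂ) * Complex.I) ∂P) atTop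
      (𝓝 (∫ ω, Complex.exp (((∑ i, c i * (Y i ω).re : ℝ) : ℂ) * Complex.I) ∂P)) := by
    refine tendsto_integral_of_dominated_convergence (fun _ => 1) (fun n => ?_)
      (integrable_const _) (fun n => ae_of_all _ fun ω => ?_) ?_
    · have := fun i => hW.measurable_simpleIntegral (hg i (ns n))
      exact Measurable.aestronglyMeasurable (by fun_prop)
    · rw [Complex.norm_exp_ofReal_mul_I]
    · filter_upwards [hae] with ω hω
      have hcont : Continuous fun v : ι → ℂ =>
          Complex.exp (((∑ i, c i * (v i).re : ℝ) : ℂ) * Complex.I) := by fun_prop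
      exact (hcont.tendsto _).comp hω
  have hlimJ : Tendsto (fun n => ∫⁻ ξ, ‖∑ i, (c i : ℂ) * g i n ξ‖ₑ ^ α) atTop
      (𝓝 (∫⁻ ξ, ‖∑ i, (c i : ℂ) * f i ξ‖ₑ ^ α)) := by
    have hmem : MemLp (fun ξ => ∑ i, |c i| * (2 * ‖f i ξ‖)) (ENNReal.ofReal α) volume :=
      memLp_finsetSum _ fun i _ => ((hY i).memLp.norm.const_mul 2).const_mul |c i|
    have hbd := lintegral_rpow_enorm_lt_top_of_eLpNorm_lt_top (by simpa using hα) (by simp) hmem.2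
    rw [ENNReal.toReal_ofReal hα.le] at hbd
    refine tendsto_lintegral_of_dominated_convergence _ (fun n => ?_)
      (fun n => ae_of_all _ fun ξ => ?_) hbd.ne (ae_of_all _ fun ξ => ?_)
    · have := fun i => (g i n).measurable
      fun_prop
    · refine ENNReal.rpow_le_rpow (enorm_le_iff_norm_le.2 ?_) hα.le
      refine (norm_sum_le _ _).trans (le_trans ?_ (le_abs_self _))
      refine Finset.sum_le_sum fun i _ => ?_
      rw [norm_mul, Complex.norm_real, Real.norm_eq_abs]
      exact mul_le_mul_of_nonneg_left (hdom i n ξ) (abs_nonneg _)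
    · have h1 : Tendsto (fun n => ∑ i, (c i : ℂ) * g i n ξ) atTop (𝓝 (∑ i, (c i : ℂ) * f i ξ)) :=
        tendsto_finsetSum _ fun i _ => (hlim i ξ).const_mul _
      exact (ENNReal.continuous_rpow_const.tendsto _).comp h1.enorm
  have hJfin : ∫⁻ ξ, ‖∑ i, (c i : ℂ) * f i ξ‖ₑ ^ α ≠ ∞ := by
    have hmem : MemLp (fun ξ => ∑ i, (c i : ℂ) * f i ξ) (ENNReal.ofReal α) volume :=
      memLp_finsetSum _ fun i _ => (hY i).memLp.const_mul _
    have hbd := lintegral_rpow_enorm_lt_top_of_eLpNorm_lt_top (by simpa using hα) (by simp) hmem.2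
    rw [ENNReal.toReal_ofReal hα.le] at hbd
    exact hbd.ne
  simp_rw [hleft] at hlimL
  refine tendsto_nhds_unique hlimL ?_
  have h1 := ((ENNReal.tendsto_toReal hJfin).comp (hlimJ.comp hns.tendsto_atTop))
  have hcont : Continuous fun r : ℝ => Complex.exp ((-(κ * r) : ℝ) : ℂ) := by fun_prop
  exact (hcont.tendsto _).comp h1

end IsIsotropicStableMeasure

end OperatorScaling

/-! ### Matrix exponentials: determinant, spectrum, growth of powers -/

namespace OperatorScaling

open scoped Matrix.Norms.Operator

lemma hasDerivAt_linearMap_exp_smul {𝔸 : Type*} [NormedRing 𝔸] [NormedAlgebra ℝ 𝔸]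
    [FiniteDimensional ℝ 𝔸] (φ : 𝔸 →ₗ[ℝ] ℝ) (x : 𝔸) :
    HasDerivAt (fun t : ℝ => φ (NormedSpace.exp (t • x))) (φ x) 0 := by
  have : CompleteSpace 𝔸 := FiniteDimensional.complete ℝ 𝔸
  have h := (LinearMap.toContinuousLinearMap φ).hasFDerivAt.comp_hasDerivAt (0 : ℝ)
    (hasDerivAt_exp_smul_const x (0 : ℝ))
  rw [zero_smul, NormedSpace.exp_zero, one_mul] at h
  exact h

lemma exists_linearMap_bound {X Y : Type*} [NormedAddCommGroup X] [NormedSpace ℝ X]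
    [FiniteDimensional ℝ X] [NormedAddCommGroup Y] [NormedSpace ℝ Y] (T : X →ₗ[ℝ] Y) :
    ∃ K : ℝ, 0 < K ∧ ∀ x, ‖T x‖ ≤ K * ‖x‖ :=
  SemilinearMapClass.bound_of_continuous T (LinearMap.continuous_of_finiteDimensional T)

section MatrixExponential

variable {n : Type*} [Fintype n] [DecidableEq n]

lemma hasDerivAt_det_one_add_smul (A : Matrix n n ℝ) :
    HasDerivAt (fun t : ℝ => (1 + t • A).det) A.trace 0 := by
  have h := (1 + (Polynomial.X : Polynomial ℝ) • A.map Polynomial.C).det.hasDerivAt (0 : ℝ)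
  rw [Matrix.derivative_det_one_add_X_smul] at h
  refine h.congr_of_eventuallyEq (Eventually.of_forall fun t => ?_)
  dsimp only
  rw [← Polynomial.coe_evalRingHom, RingHom.map_det]
  congr 1
  ext i j
  have h1 : Polynomial.eval t ((1 : Matrix n n (Polynomial ℝ)) i j) = (1 : Matrix n n ℝ) i j := by
    rw [Matrix.one_apply, Matrix.one_apply]
    split_ifs <;> simp
  rw [RingHom.mapMatrix_apply, Matrix.map_apply, Matrix.add_apply, Matrix.add_apply, map_add,
    Polynomial.coe_evalRingHom, h1]
  simp [mul_comm t]

/-- The curves `exp (tA)` and `1 + tA` pass through 1 with the same velocity, so the determinant has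
the same derivative along both; along the second it is a polynomial in `t`. -/
lemma hasDerivAt_det_exp_smul (A : Matrix n n ℝ) :
    HasDerivAt (fun t : ℝ => (NormedSpace.exp (t • A)).det) A.trace 0 := by
  let D : (n → n → ℝ) → ℝ := fun X => (Matrix.of X).det
  have hD : DifferentiableAt ℝ D (1 : Matrix n n ℝ) := by
    simp only [D, Matrix.det_apply, Matrix.of_apply]
    fun_prop
  have hline : HasDerivAt (fun (t : ℝ) i j => ((1 : Matrix n n ℝ) + t • A) i j) A 0 := by
    refine hasDerivAt_pi.2 fun i => hasDerivAt_pi.2 fun j => ?_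
    simpa using ((hasDerivAt_id (0 : ℝ)).mul_const (A i j)).const_add ((1 : Matrix n n ℝ) i j)
  have hexp : HasDerivAt (fun (t : ℝ) i j => (NormedSpace.exp (t • A) : Matrix n n ℝ) i j) A 0 :=
    hasDerivAt_pi.2 fun i => hasDerivAt_pi.2 fun j =>
      hasDerivAt_linearMap_exp_smul (Matrix.entryLinearMap ℝ ℝ i j) A
  have h1 := hD.hasFDerivAt.comp_hasDerivAt_of_eq (0 : ℝ) hline (by simp; rfl)
  have h2 := hD.hasFDerivAt.comp_hasDerivAt_of_eq (0 : ℝ) hexp (by simp; rfl)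
  rw [h1.unique (hasDerivAt_det_one_add_smul A)] at h2
  exact h2

/-- The determinant `φ` is multiplicative in `t`, so the derivative at 0 gives `φ' = φ · tr A`
everywhere, and `φ(t) e^{-t tr A}` is constant. -/
lemma det_exp_smul (A : Matrix n n ℝ) (t : ℝ) :
    (NormedSpace.exp (t • A)).det = Real.exp (t * A.trace) := by
  set φ : ℝ → ℝ := fun t => (NormedSpace.exp (t • A)).det with hφ
  have hadd : ∀ s t, φ (s + t) = φ s * φ t := fun s t => by
    simp only [hφ]
    rw [add_smul, Matrix.exp_add_of_commute _ _
      (((Commute.refl A).smul_left s).smul_right t), Matrix.det_mul]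
  have hd : ∀ t, HasDerivAt φ (φ t * A.trace) t := fun t => by
    have h0 : HasDerivAt φ A.trace (t - t) := by
      rw [sub_self]; exact hasDerivAt_det_exp_smul A
    have h1 := (h0.comp_sub_const t t).const_mul (φ t)
    refine h1.congr_of_eventuallyEq (Eventually.of_forall fun s => ?_)
    dsimp only
    rw [← hadd, add_sub_cancel]
  have hd' : ∀ t, HasDerivAt (fun t => φ t * Real.exp (-(t * A.trace))) 0 t := fun t => by
    have h2 : HasDerivAt (fun t => Real.exp (-(t * A.trace)))
        (Real.exp (-(t * A.trace)) * -(1 * A.trace)) t :=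
      (((hasDerivAt_id t).mul_const A.trace).neg).exp
    convert! (hd t).mul h2 using 1
    ring
  have hc := is_const_of_deriv_eq_zero (fun t => (hd' t).differentiableAt)
    (fun t => (hd' t).deriv) t 0
  simp only [hφ, zero_smul, NormedSpace.exp_zero, Matrix.det_one, zero_mul, neg_zero,
    Real.exp_zero, mul_one] at hc
  rw [Real.exp_neg] at hc
  field_simp at hc
  exact hc

lemma exp_smul_mulVec_of_mulVec_eq (A : Matrix n n ℂ) (s : ℂ) {v : n → ℂ} {a : ℂ}
    (h : A.mulVec v = a • v) : (NormedSpace.exp (s • A)).mulVec v = Complex.exp (s * a) • v := by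
  have hpow : ∀ k : ℕ, ((s • A) ^ k).mulVec v = (s * a) ^ k • v := by
    intro k
    induction k with
    | zero => simp
    | succ k ih =>
      rw [pow_succ, ← Matrix.mulVec_mulVec, Matrix.smul_mulVec, h, smul_smul, Matrix.mulVec_smul,
        ih, smul_smul, pow_succ']
  have h1 := NormedSpace.exp_series_hasSum_exp' (𝕂 := ℂ) (s • A)
  let T : Matrix n n ℂ →ₗ[ℂ] (n → ℂ) := (Matrix.mulVecBilin ℂ ℂ).flip v
  have hT : ∀ X, T X = X.mulVec v := fun X => rfl
  have h2 := (LinearMap.toContinuousLinearMap T).hasSum h1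
  have h3 := (NormedSpace.exp_series_hasSum_exp' (𝕂 := ℂ) (s * a)).smul_const v
  simp only [LinearMap.coe_toContinuousLinearMap', map_smul, hT, hpow] at h2
  simp only [smul_assoc] at h3
  rw [Complex.exp_eq_exp_ℂ]
  exact h2.unique h3

/-- An eigenspace of `exp (sA)` is invariant under the commuting matrix `A`, hence contains an
eigenvector of `A`, on which the exponential is explicit. -/
lemma exists_mem_spectrum_of_mem_spectrum_exp_smul (A : Matrix n n ℂ) (s : ℂ) {z : ℂ}
    (hz : z ∈ spectrum ℂ (NormedSpace.exp (s • A))) :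
    ∃ a ∈ spectrum ℂ A, z = Complex.exp (s * a) := by
  rw [← Matrix.spectrum_toLin', ← Module.End.hasEigenvalue_iff_mem_spectrum] at hz
  set g := Matrix.toLin' (NormedSpace.exp (s • A)) with hg
  set V := Module.End.eigenspace g z with hV
  have hcomm : Commute (Matrix.toLin' A) g := by
    have h1 : Commute A (NormedSpace.exp (s • A)) :=
      ((Commute.refl A).smul_right s).exp_right
    exact h1.map (Matrix.toLinAlgEquiv' (R := ℂ) (n := n))
  have hmaps : ∀ x ∈ V, Matrix.toLin' A x ∈ V := by
    intro x hx
    rw [hV, Module.End.mem_eigenspace_iff] at hx ⊢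
    have := LinearMap.congr_fun hcomm.eq x
    rw [Module.End.mul_apply, Module.End.mul_apply, hx, map_smul] at this
    exact this.symm
  have : Nontrivial V := Submodule.nontrivial_iff_ne_bot.2 hz
  obtain ⟨a, ha⟩ := Module.End.exists_eigenvalue ((Matrix.toLin' A).restrict hmaps)
  obtain ⟨v, hv⟩ := ha.exists_hasEigenvector
  have hv1 : A.mulVec (v : n → ℂ) = a • (v : n → ℂ) := by
    simpa using congrArg Subtype.val hv.apply_eq_smul
  have hv0 : (v : n → ℂ) ≠ 0 := fun h => hv.2 (Subtype.ext h)
  refine ⟨a, ?_, ?_⟩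
  · rw [← Matrix.spectrum_toLin', ← Module.End.hasEigenvalue_iff_mem_spectrum]
    exact Module.End.hasEigenvalue_of_hasEigenvector
      (x := (v : n → ℂ)) ⟨by rw [Module.End.mem_eigenspace_iff]; simpa using hv1, hv0⟩
  · have h1 := exp_smul_mulVec_of_mulVec_eq A s hv1
    have h2 : g v = z • (v : n → ℂ) := Module.End.mem_eigenspace_iff.1 v.2
    rw [hg, Matrix.toLin'_apply, h1] at h2
    exact (smul_left_injective ℂ hv0 h2).symm

/-- Gelfand's formula, with `r` chosen strictly between the spectral radius and `R`; `C` absorbs the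
finitely many small powers. -/
lemma exists_norm_pow_le_of_spectrum_lt [Nonempty n] (A : Matrix n n ℂ) {R : ℝ}
    (hR : 0 < R) (hA : ∀ z ∈ spectrum ℂ A, ‖z‖ < R) :
    ∃ C r : ℝ, 0 < C ∧ 0 < r ∧ r < R ∧ ∀ k : ℕ, ‖A ^ k‖ ≤ C * r ^ k := by
  lift R to NNReal using hR.le
  have hρ := spectrum.spectralRadius_lt_of_forall_lt A (r := R) fun z hz => by
    exact_mod_cast hA z hz
  obtain ⟨r, hr1, hr2⟩ := ENNReal.lt_iff_exists_nnreal_btwn.1 hρ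
  have hr0 : 0 < r := by
    exact_mod_cast pos_of_gt hr1
  have hlim := (spectrum.pow_norm_pow_one_div_tendsto_nhds_spectralRadius A).eventually_lt_const hr1
  have hO : (fun k : ℕ => A ^ k) =O[atTop] fun k => (r : ℝ) ^ k := by
    refine Asymptotics.IsBigO.of_bound 1 ?_
    filter_upwards [hlim, eventually_gt_atTop 0] with k hk hk0
    rw [← ENNReal.ofReal_coe_nnreal, ENNReal.ofReal_lt_ofReal_iff (by exact_mod_cast hr0)] at hk
    rw [one_mul, Real.norm_of_nonneg (by positivity)]
    calc ‖A ^ k‖ = (‖A ^ k‖ ^ (1 / (k : ℝ))) ^ k := by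
          rw [one_div, Real.rpow_inv_natCast_pow (norm_nonneg _) hk0.ne']
      _ ≤ _ := pow_le_pow_left₀ (by positivity) hk.le k
  obtain ⟨C, hC, hCb⟩ := Asymptotics.bound_of_isBigO_nat_atTop hO
  refine ⟨C, r, hC, by exact_mod_cast hr0, by exact_mod_cast hr2, fun k => ?_⟩
  have h : (r : ℝ) ^ k ≠ 0 := (pow_pos (by exact_mod_cast hr0) k).ne'
  simpa using hCb h

end MatrixExponential

/-! ### The group `c^E`: adjoint, Jacobian and contraction rate -/

section Powers

variable {d : ℕ} (E : Matrix (Fin d) (Fin d) ℝ)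

lemma matPow_one : matPow 1 E = 1 := by
  simp [matPow]

lemma matPow_mul {b c : ℝ} (hb : 0 < b) (hc : 0 < c) :
    matPow (b * c) E = matPow b E * matPow c E := by
  rw [matPow, matPow, matPow, Real.log_mul hb.ne' hc.ne', add_smul, Matrix.exp_add_of_commute _ _
    (((Commute.refl E).smul_left _).smul_right _)]

lemma matPow_pow {b : ℝ} (k : ℕ) : matPow (b ^ k) E = matPow b E ^ k := by
  rw [matPow, matPow, Real.log_pow, mul_smul, ← Matrix.exp_nsmul, Nat.cast_smul_eq_nsmul]

lemma matPow_transpose (c : ℝ) : matPow c E.transpose = (matPow c E).transpose := by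
  rw [matPow, matPow, ← Matrix.exp_transpose, Matrix.transpose_smul]

lemma det_matPow {c : ℝ} (hc : 0 < c) : (matPow c E).det = c ^ E.trace := by
  rw [matPow, det_exp_smul, Real.rpow_def_of_pos hc]

lemma powAct_one (x : Rd d) : powAct 1 E x = x := by
  simp [powAct, matPow_one]

lemma powAct_mul {b c : ℝ} (hb : 0 < b) (hc : 0 < c) (x : Rd d) :
    powAct (b * c) E x = powAct b E (powAct c E x) := by
  simp [powAct, matPow_mul E hb hc]

lemma powAct_inv_powAct {c : ℝ} (hc : 0 < c) (x : Rd d) :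
    powAct c⁻¹ E (powAct c E x) = x := by
  rw [← powAct_mul E (inv_pos.2 hc) hc, inv_mul_cancel₀ hc.ne', powAct_one]

lemma powAct_powAct_inv {c : ℝ} (hc : 0 < c) (x : Rd d) :
    powAct c E (powAct c⁻¹ E x) = x := by
  rw [← powAct_mul E hc (inv_pos.2 hc), mul_inv_cancel₀ hc.ne', powAct_one]

lemma powAct_zero (c : ℝ) : powAct c E 0 = 0 := map_zero _

lemma powAct_ne_zero {c : ℝ} (hc : 0 < c) {x : Rd d} (hx : x ≠ 0) : powAct c E x ≠ 0 := by
  intro h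
  rw [← powAct_inv_powAct E hc x, h, powAct_zero] at hx
  exact hx rfl

lemma continuous_powAct (c : ℝ) : Continuous (powAct c E) :=
  LinearMap.continuous_of_finiteDimensional (Matrix.toEuclideanLin (matPow c E))

lemma inner_powAct_left (c : ℝ) (x ξ : Rd d) :
    inner ℝ (powAct c E x) ξ = inner ℝ x (powAct c E.transpose ξ) := by
  have h : matPow c E.transpose = (matPow c E).conjTranspose := by
    rw [matPow_transpose, Matrix.conjTranspose_eq_transpose_of_trivial]
  rw [powAct, powAct, h, Matrix.toEuclideanLin_conjTranspose_eq_adjoint,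
    LinearMap.adjoint_inner_right]

lemma map_powAct_volume {c : ℝ} (hc : 0 < c) :
    (volume : Measure (Rd d)).map (powAct c E) = ENNReal.ofReal (c ^ (-E.trace)) • volume := by
  have hdet : LinearMap.det (Matrix.toEuclideanLin (matPow c E)) = c ^ E.trace := by
    rw [Matrix.toEuclideanLin, Matrix.toLpLin_eq_toLin, LinearMap.det_toLin, det_matPow E hc]
  have hpos : 0 < c ^ E.trace := Real.rpow_pos_of_pos hc _
  have h := Measure.map_linearMap_addHaar_eq_smul_addHaar (volume : Measure (Rd d))
    (f := Matrix.toEuclideanLin (matPow c E)) (by rw [hdet]; exact hpos.ne')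
  rw [hdet, abs_of_pos (inv_pos.2 hpos), ← Real.rpow_neg hc.le] at h
  exact h

lemma lintegral_comp_powAct {c : ℝ} (hc : 0 < c) {f : Rd d → ℝ≥0∞} (hf : Measurable f) :
    ∫⁻ x, f (powAct c E x) = ENNReal.ofReal (c ^ (-E.trace)) * ∫⁻ x, f x := by
  rw [← lintegral_map hf (continuous_powAct E c).measurable, map_powAct_volume E hc,
    lintegral_smul_measure, smul_eq_mul]

lemma volume_preimage_powAct {c : ℝ} (hc : 0 < c) {s : Set (Rd d)} (hs : MeasurableSet s) :
    volume (powAct c E ⁻¹' s) = ENNReal.ofReal (c ^ (-E.trace)) * volume s := by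
  rw [← Measure.map_apply (continuous_powAct E c).measurable hs, map_powAct_volume E hc]
  rfl

lemma exists_norm_powAct_le (b : ℝ) :
    ∃ K : ℝ, 1 ≤ K ∧ ∀ x, ‖powAct b E x‖ ≤ K * ‖x‖ := by
  let T := LinearMap.toContinuousLinearMap (Matrix.toEuclideanLin (matPow b E))
  refine ⟨max 1 ‖T‖, le_max_left _ _, fun x => (T.le_opNorm x).trans ?_⟩
  gcongr
  exact le_max_right _ _

lemma complexSpectrum_transpose : complexSpectrum E.transpose = complexSpectrum E := by
  ext z
  rw [complexSpectrum, complexSpectrum, Matrix.transpose_map, spectrum.mem_iff, spectrum.mem_iff,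
    ← Matrix.isUnit_transpose, Matrix.transpose_sub, Matrix.transpose_transpose,
    Matrix.algebraMap_eq_diagonal, Matrix.diagonal_transpose]

/-- If the eigenvalues of `E` have real part greater than `H`, then `2^{-kE}` is exponentially
smaller than `2^{-kH}` as `k → ∞`. -/
lemma exists_norm_powAct_half_pow_le {H : ℝ} (hH : ∀ μ ∈ complexSpectrum E, H < μ.re) :
    ∃ C r : ℝ, 0 < C ∧ 0 < r ∧ r < 2 ^ (-H) ∧
      ∀ (k : ℕ) (x : Rd d), ‖powAct ((1 / 2) ^ k) E x‖ ≤ C * r ^ k * ‖x‖ := by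
  have hR : (0 : ℝ) < 2 ^ (-H) := by positivity
  rcases isEmpty_or_nonempty (Fin d) with hd | hd
  · refine ⟨1, 2 ^ (-H) / 2, one_pos, by positivity, by linarith, fun k x => ?_⟩
    rw [Subsingleton.elim (powAct ((1 / 2) ^ k) E x) 0, norm_zero]
    positivity
  set B : Matrix (Fin d) (Fin d) ℂ := E.map (algebraMap ℝ ℂ) with hB
  set s : ℂ := ((Real.log (1 / 2) : ℝ) : ℂ) with hs
  -- Each eigenvalue of `(1/2)^E` has modulus `2^{-Re a}` for some eigenvalue `a` of `E`, hence is
  -- below `2^{-H}`.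
  obtain ⟨C, r, hC, hr, hrR, hb⟩ := exists_norm_pow_le_of_spectrum_lt (NormedSpace.exp (s • B)) hR
    (fun z hz => by
      obtain ⟨a, ha, rfl⟩ := exists_mem_spectrum_of_mem_spectrum_exp_smul B s hz
      rw [Complex.norm_exp, Real.rpow_def_of_pos two_pos, Real.exp_lt_exp, hs,
        Complex.re_ofReal_mul, one_div, Real.log_inv]
      nlinarith [hH a ha, Real.log_pos one_lt_two])
  have hmap : NormedSpace.exp (s • B) = (matPow (1 / 2) E).map (algebraMap ℝ ℂ) := by
    have h1 := NormedSpace.map_exp ((algebraMap ℝ ℂ).mapMatrix (m := Fin d))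
      (by
        change Continuous fun X : Matrix (Fin d) (Fin d) ℝ => X.map (algebraMap ℝ ℂ)
        exact continuous_id.matrix_map (continuous_algebraMap ℝ ℂ)) (Real.log (1 / 2) • E)
    rw [RingHom.mapMatrix_apply, RingHom.mapMatrix_apply] at h1
    rw [matPow]
    refine Eq.trans ?_ h1.symm
    congr 1
    ext i j
    simp [hB, hs]
  -- Taking real parts recovers the real operator from its complexified matrix; boundedness of this
  -- linear map transfers the complex norm estimate.
  let T : Matrix (Fin d) (Fin d) ℂ →ₗ[ℝ] (Rd d →L[ℝ] Rd d) :=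
    (LinearMap.toContinuousLinearMap.toLinearMap ∘ₗ
      (Matrix.toEuclideanLin (𝕜 := ℝ) (m := Fin d) (n := Fin d)).toLinearMap) ∘ₗ
        Complex.reLm.mapMatrix
  obtain ⟨K, hK0, hT⟩ := exists_linearMap_bound T
  have hK : ∀ X : Matrix (Fin d) (Fin d) ℝ, ∀ x : Rd d,
      ‖Matrix.toEuclideanLin X x‖ ≤ K * ‖X.map (algebraMap ℝ ℂ)‖ * ‖x‖ := by
    intro X x
    have h1 := hT (X.map (algebraMap ℝ ℂ))
    have h2 := (T (X.map (algebraMap ℝ ℂ))).le_opNorm x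
    have h3 : T (X.map (algebraMap ℝ ℂ)) x = Matrix.toEuclideanLin X x := by
      have : (X.map (algebraMap ℝ ℂ)).map Complex.reLm = X := by ext i j; simp
      simp only [T, LinearMap.comp_apply, LinearMap.mapMatrix_apply, this]
      rfl
    rw [h3] at h2
    exact h2.trans (by gcongr)
  refine ⟨K * C, r, by positivity, hr, hrR, fun k x => ?_⟩
  have h4 : (matPow ((1 / 2) ^ k) E).map (algebraMap ℝ ℂ) = NormedSpace.exp (s • B) ^ k := by
    rw [hmap, matPow_pow, ← RingHom.mapMatrix_apply, map_pow, RingHom.mapMatrix_apply]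
  calc _ ≤ K * ‖(matPow ((1 / 2) ^ k) E).map (algebraMap ℝ ℂ)‖ * ‖x‖ := hK _ _
    _ ≤ K * (C * r ^ k) * ‖x‖ := by
        rw [h4]
        gcongr
        exact hb k
    _ = _ := by ring

end Powers

end OperatorScaling

/-! ### Homogeneous functions and their dyadic annuli -/

namespace OperatorScaling

section Homogeneous

variable {d : ℕ} {F : Matrix (Fin d) (Fin d) ℝ} {ψ : Rd d → ℝ}

lemma norm_powAct_pow_le {b K : ℝ} (hb : 0 < b) (hK0 : 0 ≤ K)
    (hK : ∀ x, ‖powAct b F x‖ ≤ K * ‖x‖) (k : ℕ) (x : Rd d) :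
    ‖powAct (b ^ k) F x‖ ≤ K ^ k * ‖x‖ := by
  induction k with
  | zero => simp [powAct_one]
  | succ k ih =>
    rw [pow_succ', powAct_mul F hb (pow_pos hb k), pow_succ', mul_assoc]
    exact (hK _).trans (by gcongr)

/-- Apply `(1/2)^F` until `ξ` first enters the unit ball, after `k` steps. If `k > 0`, the entry
point lies in the compact shell `K⁻¹ ≤ ‖η‖ ≤ 1`, where `ψ ≥ m > 0`. But `ψ` there equals `2^{-k} ψ ξ
≤ 2^{-k} M`, which bounds `k`, and `‖ξ‖ ≤ K^k`. -/
lemma exists_norm_le_of_isHomogeneous (hF : ∀ μ ∈ complexSpectrum F, 0 < μ.re)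
    (hcont : Continuous ψ) (hhom : IsHomogeneous F ψ) (hpos : ∀ ξ, ξ ≠ 0 → 0 < ψ ξ) (M : ℝ) :
    ∃ R : ℝ, 0 < R ∧ ∀ ξ, ξ ≠ 0 → ψ ξ ≤ M → ‖ξ‖ ≤ R := by
  obtain ⟨C, r, hC, hr, hr1, hdecay⟩ := exists_norm_powAct_half_pow_le F hF
  rw [neg_zero, Real.rpow_zero] at hr1
  obtain ⟨K, hK1, hK⟩ := exists_norm_powAct_le F 2
  have hK0 : 0 < K := by linarith
  have hcompact : IsCompact {η : Rd d | K⁻¹ ≤ ‖η‖ ∧ ‖η‖ ≤ 1} := by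
    refine Metric.isCompact_of_isClosed_isBounded ?_ ?_
    · exact (isClosed_le continuous_const continuous_norm).inter
        (isClosed_le continuous_norm continuous_const)
    · exact (Metric.isBounded_closedBall (x := (0 : Rd d)) (r := 1)).subset fun η hη => by
        simpa using hη.2
  obtain ⟨m, hm, hmψ⟩ := hcompact.exists_forall_le' hcont.continuousOn (a := 0) fun η hη => by
    refine hpos η fun h => ?_
    have := hη.1
    rw [h, norm_zero] at this
    exact absurd (inv_pos.2 hK0) (not_lt.2 this)
  have hlim : Tendsto (fun k : ℕ => (1 / 2 : ℝ) ^ k * M) atTop (𝓝 0) := by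
    simpa using (tendsto_pow_atTop_nhds_zero_of_lt_one (by norm_num : (0 : ℝ) ≤ 1 / 2)
      (by norm_num)).mul_const M
  obtain ⟨N, hN⟩ := eventually_atTop.1 (hlim.eventually_lt_const hm)
  refine ⟨K ^ N, pow_pos hK0 N, fun ξ hξ hξM => ?_⟩
  have hex : ∃ k : ℕ, ‖powAct ((1 / 2) ^ k) F ξ‖ ≤ 1 := by
    have h0 : Tendsto (fun k : ℕ => C * r ^ k * ‖ξ‖) atTop (𝓝 0) := by
      simpa using ((tendsto_pow_atTop_nhds_zero_of_lt_one hr.le hr1).const_mul C).mul_const ‖ξ‖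
    obtain ⟨k, hk⟩ := (h0.eventually_lt_const one_pos).exists
    exact ⟨k, (hdecay k ξ).trans hk.le⟩
  classical
  obtain ⟨k, hk, hmin⟩ : ∃ k : ℕ, ‖powAct ((1 / 2) ^ k) F ξ‖ ≤ 1 ∧
      ∀ j < k, ¬ ‖powAct ((1 / 2) ^ j) F ξ‖ ≤ 1 :=
    ⟨Nat.find hex, Nat.find_spec hex, fun j hj => Nat.find_min hex hj⟩
  have hback : ∀ j : ℕ, powAct (2 ^ j) F (powAct ((1 / 2) ^ j) F ξ) = ξ := fun j => by
    rw [← powAct_mul F (by positivity) (by positivity), ← mul_pow]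
    norm_num [powAct_one]
  have hξk : ‖ξ‖ ≤ K ^ k := by
    calc ‖ξ‖ = ‖powAct (2 ^ k) F (powAct ((1 / 2) ^ k) F ξ)‖ := by rw [hback]
      _ ≤ K ^ k * ‖powAct ((1 / 2) ^ k) F ξ‖ := norm_powAct_pow_le two_pos hK0.le hK k _
      _ ≤ K ^ k := mul_le_of_le_one_right (by positivity) hk
  refine hξk.trans (pow_le_pow_right₀ hK1 ?_)
  rcases k with _ | j
  · exact Nat.zero_le _
  by_contra! hlt
  have h1 := not_le.1 (hmin j j.lt_succ_self)
  have h2 : powAct ((1 / 2) ^ j) F ξ = powAct 2 F (powAct ((1 / 2) ^ (j + 1)) F ξ) := by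
    rw [← powAct_mul F two_pos (by positivity), pow_succ', ← mul_assoc]
    norm_num
  rw [h2] at h1
  have h3 : K⁻¹ ≤ ‖powAct ((1 / 2) ^ (j + 1)) F ξ‖ := by
    rw [inv_le_iff_one_le_mul₀' hK0]
    exact h1.le.trans (hK _)
  have h4 := hmψ _ ⟨h3, hk⟩
  rw [hhom _ (by positivity) ξ hξ] at h4
  have h5 := hN (j + 1) hlt.le
  have h6 : (1 / 2 : ℝ) ^ (j + 1) * ψ ξ ≤ (1 / 2) ^ (j + 1) * M := by gcongr
  linarith

/-- The annulus on which `ψ` lies between `c` and `2c`. -/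
def annulus (ψ : Rd d → ℝ) (c : ℝ) : Set (Rd d) := {ξ | ξ ≠ 0 ∧ c ≤ ψ ξ ∧ ψ ξ ≤ 2 * c}

lemma measurableSet_annulus (hcont : Continuous ψ) (c : ℝ) : MeasurableSet (annulus ψ c) :=
  (measurableSet_singleton (0 : Rd d)).compl.inter
    ((measurableSet_le measurable_const hcont.measurable).inter
      (measurableSet_le hcont.measurable measurable_const))

lemma annulus_eq_preimage (hhom : IsHomogeneous F ψ) {c : ℝ} (hc : 0 < c) :
    annulus ψ c = powAct c⁻¹ F ⁻¹' annulus ψ 1 := by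
  have hc' := inv_pos.2 hc
  ext ξ
  by_cases hξ : ξ = 0
  · simp [annulus, hξ, powAct_zero]
  · simp only [annulus, Set.mem_ofPred_eq, Set.mem_preimage, hhom _ hc' ξ hξ, ne_eq, hξ,
      powAct_ne_zero F hc' hξ, not_false_eq_true, true_and, mul_one]
    rw [inv_mul_le_iff₀ hc, le_inv_mul_iff₀ hc, mul_one, mul_comm c 2]

lemma volume_annulus (hcont : Continuous ψ) (hhom : IsHomogeneous F ψ) {c : ℝ} (hc : 0 < c) :
    volume (annulus ψ c) = ENNReal.ofReal (c ^ F.trace) * volume (annulus ψ 1) := by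
  rw [annulus_eq_preimage hhom hc, volume_preimage_powAct F (inv_pos.2 hc)
    (measurableSet_annulus hcont 1), Real.inv_rpow hc.le, Real.rpow_neg hc.le, inv_inv]

/-- Only a cover is needed for upper bounds, so overlapping boundaries do no harm. -/
lemma subset_iUnion_annulus (hpos : ∀ ξ, ξ ≠ 0 → 0 < ψ ξ) :
    (Set.univ : Set (Rd d)) ⊆
      {0} ∪ ((⋃ k : ℕ, annulus ψ (2 ^ k)) ∪ ⋃ k : ℕ, annulus ψ ((1 / 2) ^ k)) := by
  intro ξ _
  by_cases hξ : ξ = 0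
  · exact .inl hξ
  refine .inr ?_
  rcases le_total 1 (ψ ξ) with h | h
  · obtain ⟨k, hk1, hk2⟩ := exists_nat_pow_near h one_lt_two
    exact .inl (Set.mem_iUnion.2 ⟨k, hξ, hk1, by rw [← pow_succ']; exact hk2.le⟩)
  · obtain ⟨k, hk1, hk2⟩ := exists_nat_pow_near_of_lt_one (hpos ξ hξ) h
      (by norm_num : (0 : ℝ) < 1 / 2) (by norm_num)
    refine .inr (Set.mem_iUnion.2 ⟨k + 1, hξ, hk1.le, hk2.trans_eq ?_⟩)
    rw [pow_succ]; ring

lemma rpow_le_of_mem_annulus {c s : ℝ} (hc : 0 < c) {ξ : Rd d} (hξ : ξ ∈ annulus ψ c) :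
    ψ ξ ^ s ≤ 2 ^ |s| * c ^ s := by
  obtain ⟨-, h1, h2⟩ := hξ
  have hu1 : 1 ≤ ψ ξ / c := (one_le_div hc).2 h1
  have hu2 : ψ ξ / c ≤ 2 := (div_le_iff₀ hc).2 h2
  calc ψ ξ ^ s = (ψ ξ / c) ^ s * c ^ s := by
        rw [← Real.mul_rpow (by linarith) hc.le, div_mul_cancel₀ _ hc.ne']
    _ ≤ 2 ^ |s| * c ^ s := by
        gcongr
        calc (ψ ξ / c) ^ s ≤ (ψ ξ / c) ^ |s| := Real.rpow_le_rpow_of_exponent_le hu1 (le_abs_self s)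
          _ ≤ 2 ^ |s| := Real.rpow_le_rpow (by linarith) hu2 (abs_nonneg s)

end Homogeneous

/-! ### The kernel: integrability, scaling and translation -/

section Kernel

variable {d : ℕ} {E : Matrix (Fin d) (Fin d) ℝ} {ψ : Rd d → ℝ} {α H : ℝ}

lemma harmonizableKernel_zero_right (x : Rd d) : harmonizableKernel E α H ψ x 0 = 0 := by
  simp [harmonizableKernel]

lemma measurable_harmonizableKernel (hcont : Continuous ψ) (x : Rd d) :
    Measurable (harmonizableKernel E α H ψ x) := by
  have := hcont.measurable
  unfold harmonizableKernel
  fun_prop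

/-- The volume factor `c^q` cancels the `c^{-q}` in `(c^{-H-q/α})^α`. The oscillating factor enters
only through `b`, to be taken as 2 on large annuli and small near the origin. -/
lemma setLIntegral_annulus_harmonizableKernel_le (hα : 0 < α) (hcont : Continuous ψ)
    (hhom : IsHomogeneous E.transpose ψ) {c b : ℝ} (hc : 0 < c) (hb : 0 ≤ b) {x : Rd d}
    (hx : ∀ ξ ∈ annulus ψ c, ‖Complex.exp (Complex.I * ((inner ℝ x ξ : ℝ) : ℂ)) - 1‖ ≤ b) :
    ∫⁻ ξ in annulus ψ c, ‖harmonizableKernel E α H ψ x ξ‖ₑ ^ α ≤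
      ENNReal.ofReal ((b * 2 ^ |-H - E.trace / α|) ^ α * c ^ (-(H * α))) *
        volume (annulus ψ 1) := by
  set s := -H - E.trace / α with hs
  have hbound : ∀ ξ ∈ annulus ψ c, ‖harmonizableKernel E α H ψ x ξ‖ₑ ^ α ≤
      ENNReal.ofReal ((b * (2 ^ |s| * c ^ s)) ^ α) := by
    intro ξ hξ
    rw [← ENNReal.ofReal_rpow_of_nonneg (by positivity) hα.le, ← ofReal_norm]
    gcongr
    have hψ0 : 0 ≤ ψ ξ := hc.le.trans hξ.2.1
    rw [harmonizableKernel, norm_mul, Complex.norm_real,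
      Real.norm_of_nonneg (Real.rpow_nonneg hψ0 _)]
    exact mul_le_mul (hx ξ hξ) (rpow_le_of_mem_annulus hc hξ) (Real.rpow_nonneg hψ0 _) hb
  calc _ ≤ ∫⁻ _ in annulus ψ c, ENNReal.ofReal ((b * (2 ^ |s| * c ^ s)) ^ α) :=
        setLIntegral_mono measurable_const hbound
    _ = ENNReal.ofReal ((b * (2 ^ |s| * c ^ s)) ^ α) *
          (ENNReal.ofReal (c ^ E.trace) * volume (annulus ψ 1)) := by
        rw [setLIntegral_const, volume_annulus hcont hhom hc, Matrix.trace_transpose]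
    _ = _ := by
        rw [← mul_assoc, ← ENNReal.ofReal_mul (by positivity)]
        congr 2
        rw [← mul_assoc, Real.mul_rpow (by positivity) (by positivity), mul_assoc,
          ← Real.rpow_mul hc.le, ← Real.rpow_add hc]
        congr 2
        rw [hs]
        field_simp
        ring

lemma memLp_harmonizableKernel (hα : 0 < α) (hH0 : 0 < H)
    (hE : ∀ μ ∈ complexSpectrum E, H < μ.re) (hcont : Continuous ψ)
    (hhom : IsHomogeneous E.transpose ψ) (hpos : ∀ ξ, ξ ≠ 0 → 0 < ψ ξ) (x : Rd d) :
    MemLp (harmonizableKernel E α H ψ x) (ENNReal.ofReal α) volume := by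
  refine ⟨(measurable_harmonizableKernel hcont x).aestronglyMeasurable, ?_⟩
  rw [eLpNorm_lt_top_iff_lintegral_rpow_enorm_lt_top (by simpa using hα) (by simp),
    ENNReal.toReal_ofReal hα.le]
  rw [← complexSpectrum_transpose] at hE
  -- The bound 2 is the largest value of `ψ` allowed on the reference annulus `annulus ψ 1`, of
  -- which all others are images.
  obtain ⟨R, hR, hRψ⟩ := exists_norm_le_of_isHomogeneous
    (fun μ hμ => hH0.trans (hE μ hμ)) hcont hhom hpos 2
  obtain ⟨C, r, hC, hr, hrH, hdecay⟩ := exists_norm_powAct_half_pow_le E.transpose hE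
  have hV : volume (annulus ψ 1) < ∞ := by
    refine (measure_mono (t := Metric.closedBall 0 R) fun ξ hξ => ?_).trans_lt
      measure_closedBall_lt_top
    simpa using hRψ ξ hξ.1 (by simpa using hξ.2.2)
  set S : ℝ := 2 ^ |-H - E.trace / α|
  have hS : 0 < S := by positivity
  have hlarge : ∑' k : ℕ, ∫⁻ ξ in annulus ψ (2 ^ k), ‖harmonizableKernel E α H ψ x ξ‖ₑ ^ α < ∞ := by
    refine (ENNReal.tsum_le_tsum fun k => setLIntegral_annulus_harmonizableKernel_le hα hcont hhom
      (b := 2) (by positivity) two_pos.le fun ξ _ => ?_).trans_lt ?_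
    · rw [mul_comm]
      refine (norm_sub_le _ _).trans ?_
      rw [Complex.norm_exp_ofReal_mul_I, norm_one]
      norm_num
    · rw [ENNReal.tsum_mul_right]
      refine ENNReal.mul_lt_top (Summable.tsum_ofReal_lt_top ?_) hV
      refine Summable.mul_left _ ?_
      have : ∀ k : ℕ, ((2 : ℝ) ^ k) ^ (-(H * α)) = (2 ^ (-(H * α))) ^ k := fun k => by
        rw [← Real.rpow_natCast, ← Real.rpow_mul two_pos.le, mul_comm, Real.rpow_mul two_pos.le,
          Real.rpow_natCast]
      simp_rw [this]
      exact summable_geometric_of_lt_one (by positivity)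
        (Real.rpow_lt_one_of_one_lt_of_neg one_lt_two (neg_neg_of_pos (by positivity)))
  have hsmall :
      ∑' k : ℕ, ∫⁻ ξ in annulus ψ ((1 / 2) ^ k), ‖harmonizableKernel E α H ψ x ξ‖ₑ ^ α < ∞ := by
    refine (ENNReal.tsum_le_tsum fun k => setLIntegral_annulus_harmonizableKernel_le hα hcont hhom
      (b := ‖x‖ * (C * r ^ k * R)) (by positivity) (by positivity) fun ξ hξ => ?_).trans_lt ?_
    · refine Real.norm_exp_I_mul_ofReal_sub_one_le.trans ((norm_inner_le_norm x ξ).trans ?_)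
      gcongr
      have hc : (0 : ℝ) < (1 / 2) ^ k := by positivity
      rw [annulus_eq_preimage hhom hc] at hξ
      calc ‖ξ‖ = ‖powAct ((1 / 2) ^ k) E.transpose (powAct ((1 / 2) ^ k)⁻¹ E.transpose ξ)‖ := by
            rw [powAct_powAct_inv _ hc]
        _ ≤ C * r ^ k * ‖powAct ((1 / 2) ^ k)⁻¹ E.transpose ξ‖ := hdecay _ _
        _ ≤ C * r ^ k * R := by
            gcongr
            exact hRψ _ hξ.1 (by simpa using hξ.2.2)
    · rw [ENNReal.tsum_mul_right]
      refine ENNReal.mul_lt_top (Summable.tsum_ofReal_lt_top ?_) hV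
      -- A geometric series of ratio `(r 2^H)^α`, which is below 1 exactly because `r < 2^{-H}`.
      have hterm : ∀ k : ℕ, (‖x‖ * (C * r ^ k * R) * S) ^ α * ((1 / 2 : ℝ) ^ k) ^ (-(H * α)) =
          (‖x‖ * C * R * S) ^ α * ((r * 2 ^ H) ^ α) ^ k := fun k => by
        have h1 : ((1 / 2 : ℝ) ^ k) ^ (-(H * α)) = ((2 ^ H) ^ k) ^ α := by
          rw [← Real.rpow_natCast, ← Real.rpow_mul (by norm_num), one_div,
            Real.inv_rpow two_pos.le, ← Real.rpow_neg two_pos.le, ← Real.rpow_natCast,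
            ← Real.rpow_mul two_pos.le, ← Real.rpow_mul two_pos.le]
          congr 1
          ring
        have h2 : ((r * 2 ^ H) ^ α) ^ k = ((r * 2 ^ H) ^ k) ^ α := by
          exact Real.rpow_pow_comm (by positivity) _ _
        rw [h1, h2, ← Real.mul_rpow (by positivity) (by positivity),
          ← Real.mul_rpow (by positivity) (by positivity), mul_pow]
        congr 1
        ring
      refine ((summable_geometric_of_lt_one (by positivity)
        (Real.rpow_lt_one (by positivity) ?_ hα)).mul_left _).congr fun k => (hterm k).symm
      rw [Real.rpow_neg two_pos.le] at hrH
      calc r * 2 ^ H < (2 ^ H)⁻¹ * 2 ^ H := by gcongr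
        _ = 1 := inv_mul_cancel₀ (by positivity)
  rw [← setLIntegral_univ]
  refine (lintegral_mono_set (subset_iUnion_annulus hpos)).trans_lt ?_
  refine (lintegral_union_le _ _ _).trans_lt (ENNReal.add_lt_top.2 ⟨?_, ?_⟩)
  · simp [harmonizableKernel_zero_right, hα]
  · refine (lintegral_union_le _ _ _).trans_lt (ENNReal.add_lt_top.2 ⟨?_, ?_⟩)
    · exact (lintegral_iUnion_le _ _).trans_lt hlarge
    · exact (lintegral_iUnion_le _ _).trans_lt hsmall

lemma harmonizableKernel_powAct (hhom : IsHomogeneous E.transpose ψ) (hpos : ∀ ξ, 0 ≤ ψ ξ)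
    {c : ℝ} (hc : 0 < c) (x ξ : Rd d) :
    harmonizableKernel E α H ψ (powAct c E x) ξ =
      ((c ^ (H + E.trace / α) : ℝ) : ℂ) *
        harmonizableKernel E α H ψ x (powAct c E.transpose ξ) := by
  rcases eq_or_ne ξ 0 with rfl | hξ
  · rw [powAct_zero, harmonizableKernel_zero_right, harmonizableKernel_zero_right, mul_zero]
  · rw [harmonizableKernel, harmonizableKernel, inner_powAct_left, hhom c hc ξ hξ,
      Real.mul_rpow hc.le (hpos ξ), mul_left_comm, ← Complex.ofReal_mul, ← mul_assoc,
      ← Real.rpow_add hc]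
    ring_nf
    simp

lemma harmonizableKernel_add_sub (x h ξ : Rd d) :
    harmonizableKernel E α H ψ (x + h) ξ - harmonizableKernel E α H ψ h ξ =
      Complex.exp (Complex.I * ((inner ℝ h ξ : ℝ) : ℂ)) * harmonizableKernel E α H ψ x ξ := by
  rw [harmonizableKernel, harmonizableKernel, harmonizableKernel, inner_add_left,
    Complex.ofReal_add, mul_add, Complex.exp_add]
  ring

/-- The kernel identity contributes `c^{Hα+q}` and the change of variables `c^{-q}`; what remains is
`(c^H)^α`. -/
lemma lintegral_sum_harmonizableKernel_powAct (hα : 0 < α) (hcont : Continuous ψ)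
    (hhom : IsHomogeneous E.transpose ψ) (hpos : ∀ ξ, 0 ≤ ψ ξ) {c : ℝ} (hc : 0 < c)
    {ι : Type*} [Fintype ι] (t : ι → ℝ) (x : ι → Rd d) :
    ∫⁻ ξ, ‖∑ i, (t i : ℂ) * harmonizableKernel E α H ψ (powAct c E (x i)) ξ‖ₑ ^ α =
      ∫⁻ ξ, ‖∑ i, ((t i * c ^ H : ℝ) : ℂ) * harmonizableKernel E α H ψ (x i) ξ‖ₑ ^ α := by
  have hpow : ∀ s : ℝ, ‖((c ^ s : ℝ) : ℂ)‖ₑ ^ α = ENNReal.ofReal (c ^ (s * α)) := fun s => by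
    rw [← ofReal_norm, Complex.norm_real, Real.norm_of_nonneg (by positivity),
      ENNReal.ofReal_rpow_of_nonneg (by positivity) hα.le, ← Real.rpow_mul hc.le]
  have hconst : ∀ (s : ℝ) (v : ι → ℂ), ‖∑ i, (t i : ℂ) * (((c ^ s : ℝ) : ℂ) * v i)‖ₑ ^ α =
      ENNReal.ofReal (c ^ (s * α)) * ‖∑ i, (t i : ℂ) * v i‖ₑ ^ α := fun s v => by
    simp_rw [mul_left_comm (t _ : ℂ)]
    rw [← Finset.mul_sum, enorm_mul, ENNReal.mul_rpow_of_nonneg _ _ hα.le, hpow]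
  have hm : Measurable fun ξ => ‖∑ i, (t i : ℂ) * harmonizableKernel E α H ψ (x i) ξ‖ₑ ^ α := by
    have := fun i => measurable_harmonizableKernel (E := E) (α := α) (H := H) hcont (x i)
    fun_prop
  simp_rw [harmonizableKernel_powAct hhom hpos hc, Complex.ofReal_mul, mul_assoc, hconst]
  rw [lintegral_const_mul' _ _ (by simp), lintegral_const_mul' _ _ (by simp),
    lintegral_comp_powAct E.transpose hc hm, ← mul_assoc, ← ENNReal.ofReal_mul (by positivity),
    ← Real.rpow_add hc, Matrix.trace_transpose]
  congr 3
  field_simp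
  ring

lemma sum_harmonizableKernel_add_sub {ι : Type*} [Fintype ι] (t : ι → ℝ) (x : ι → Rd d)
    (h ξ : Rd d) :
    ‖∑ i, (t i : ℂ) * (harmonizableKernel E α H ψ (x i + h) ξ - harmonizableKernel E α H ψ h ξ)‖ₑ =
      ‖∑ i, (t i : ℂ) * harmonizableKernel E α H ψ (x i) ξ‖ₑ := by
  simp_rw [harmonizableKernel_add_sub, mul_left_comm (t _ : ℂ)]
  rw [← Finset.mul_sum, enorm_mul, mul_comm Complex.I]
  simp [← ofReal_norm, Complex.norm_exp_ofReal_mul_I]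

end Kernel

/-! ### Finite-dimensional distributions of the field -/

section Field

variable {d : ℕ} {E : Matrix (Fin d) (Fin d) ℝ} {ψ : Rd d → ℝ} {α H κ : ℝ}
  {Ω : Type*} [MeasurableSpace Ω] {P : Measure Ω} [IsProbabilityMeasure P]
  {W : Set (Rd d) → Ω → ℂ} {X : Rd d → Ω → ℝ}

/-- Cramér–Wold: a functional on `ι → ℝ` is the linear combination given by its values on the
standard basis, and the characteristic function on the dual determines the law. -/
lemma identDistrib_of_integral_exp_eq {ι : Type*} [Fintype ι] {U V : ι → Ω → ℝ}
    (hU : ∀ i, AEMeasurable (U i) P) (hV : ∀ i, AEMeasurable (V i) P)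
    (h : ∀ t : ι → ℝ, ∫ ω, Complex.exp (((∑ i, t i * U i ω : ℝ) : ℂ) * Complex.I) ∂P =
      ∫ ω, Complex.exp (((∑ i, t i * V i ω : ℝ) : ℂ) * Complex.I) ∂P) :
    IdentDistrib (fun ω i => U i ω) (fun ω i => V i ω) P P := by
  classical
  have hU' : AEMeasurable (fun ω i => U i ω) P := aemeasurable_pi_lambda _ hU
  have hV' : AEMeasurable (fun ω i => V i ω) P := aemeasurable_pi_lambda _ hV
  refine ⟨hU', hV', ?_⟩
  have := Measure.isProbabilityMeasure_map hU'
  have := Measure.isProbabilityMeasure_map hV'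
  refine Measure.ext_of_charFunDual (funext fun L => ?_)
  have hL : ∀ v : ι → ℝ, L v = ∑ i, L (Pi.single i 1) * v i := fun v => by
    conv_lhs => rw [← Finset.univ_sum_single v, map_sum]
    refine Finset.sum_congr rfl fun i _ => ?_
    rw [mul_comm, ← smul_eq_mul, ← map_smul, ← Pi.single_smul, smul_eq_mul, mul_one]
  rw [charFunDual_apply, charFunDual_apply, integral_map hU' (by fun_prop),
    integral_map hV' (by fun_prop)]
  have hint : ∀ V : Ω → ι → ℝ, ∫ ω, Complex.exp ((L (V ω) : ℂ) * Complex.I) ∂P =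
      ∫ ω, Complex.exp (((∑ i, L (Pi.single i 1) * V ω i : ℝ) : ℂ) * Complex.I) ∂P := fun V =>
    integral_congr_ae (ae_of_all _ fun ω => by dsimp only; rw [hL (V ω)])
  rw [hint, hint]
  exact h _

omit [IsProbabilityMeasure P] in
lemma IsHarmonizableField.aemeasurable (hX : IsHarmonizableField E α H ψ P W X) (x : Rd d) :
    AEMeasurable (X x) P := by
  obtain ⟨Y, hY, hXY⟩ := hX x
  exact (Complex.measurable_re.comp hY.measurable).aemeasurable.congr hXY.symm

lemma IsHarmonizableField.integral_exp_sum (hX : IsHarmonizableField E α H ψ P W X)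
    (hW : IsIsotropicStableMeasure α κ P W) (hα : 0 < α) (hcont : Continuous ψ)
    {ι : Type*} [Fintype ι] (x : ι → Rd d) (t : ι → ℝ) :
    ∫ ω, Complex.exp (((∑ i, t i * X (x i) ω : ℝ) : ℂ) * Complex.I) ∂P =
      Complex.exp ((-(κ * (∫⁻ ξ, ‖∑ i, (t i : ℂ) *
        harmonizableKernel E α H ψ (x i) ξ‖ₑ ^ α).toReal) : ℝ) : ℂ) := by
  choose Y hY hXY using fun i => hX (x i)
  rw [← hW.integral_exp_sum_isStableIntegral hα
    (fun i => measurable_harmonizableKernel hcont (x i)) hY t]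
  refine integral_congr_ae ?_
  filter_upwards [ae_all_iff.2 hXY] with ω hω
  simp_rw [hω]

lemma IsHarmonizableField.isOperatorScaling (hX : IsHarmonizableField E α H ψ P W X)
    (hW : IsIsotropicStableMeasure α κ P W) (hα : 0 < α) (hcont : Continuous ψ)
    (hhom : IsHomogeneous E.transpose ψ) (hpos : ∀ ξ, 0 ≤ ψ ξ) :
    IsOperatorScaling P E H X := by
  intro c hc m x
  refine identDistrib_of_integral_exp_eq (fun i => hX.aemeasurable _)
    (fun i => (hX.aemeasurable _).const_mul _) fun t => ?_
  simp_rw [← mul_assoc]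
  rw [hX.integral_exp_sum hW hα hcont (fun i => powAct c E (x i)) t,
    hX.integral_exp_sum hW hα hcont x fun i => t i * c ^ H,
    lintegral_sum_harmonizableKernel_powAct hα hcont hhom hpos hc]

lemma IsHarmonizableField.hasStationaryIncrements (hX : IsHarmonizableField E α H ψ P W X)
    (hW : IsIsotropicStableMeasure α κ P W) (hα : 0 < α) (hcont : Continuous ψ) :
    HasStationaryIncrements P X := by
  intro h m x
  refine identDistrib_of_integral_exp_eq
    (fun i => (hX.aemeasurable _).sub (hX.aemeasurable _))
    (fun i => hX.aemeasurable _) fun t => ?_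
  -- A combination of increments is a combination of `m + 1` values of the field; the extra index
  -- `none` carries the point `h` with weight `-∑ t i`.
  have h1 := hX.integral_exp_sum hW hα hcont
    (fun o : Option (Fin m) => o.elim h fun i => x i + h) fun o => o.elim (-∑ i, t i) t
  simp only [Fintype.sum_option, Option.elim] at h1
  have hsum : ∀ ω, ∑ i, t i * (X (x i + h) ω - X h ω) =
      (-∑ i, t i) * X h ω + ∑ i, t i * X (x i + h) ω := fun ω => by
    simp only [mul_sub, Finset.sum_sub_distrib, ← Finset.sum_mul]
    ring
  have hker : ∀ ξ, ∑ i, (t i : ℂ) *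
      (harmonizableKernel E α H ψ (x i + h) ξ - harmonizableKernel E α H ψ h ξ) =
      ((-∑ i, t i : ℝ) : ℂ) * harmonizableKernel E α H ψ h ξ +
        ∑ i, (t i : ℂ) * harmonizableKernel E α H ψ (x i + h) ξ := fun ξ => by
    simp only [mul_sub, Finset.sum_sub_distrib, ← Finset.sum_mul]
    push_cast
    ring
  rw [hX.integral_exp_sum hW hα hcont x t]
  simp_rw [← sum_harmonizableKernel_add_sub t x h, hsum, hker]
  exact h1

end Field

end OperatorScaling

theorem corollary4p2 {d : ℕ} (E : Matrix (Fin d) (Fin d) ℝ)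
    (hE : ∀ μ ∈ OperatorScaling.complexSpectrum E, 0 < μ.re)
    (ψ : OperatorScaling.Rd d → ℝ) (hψ_nonneg : ∀ ξ, 0 ≤ ψ ξ) (hψ_cont : Continuous ψ)
    (hψ_hom : OperatorScaling.IsHomogeneous E.transpose ψ) (hψ_ne : ∀ ξ, ξ ≠ 0 → ψ ξ ≠ 0)
    (α : ℝ) (hα0 : 0 < α) (hα2 : α ≤ 2)
    (H : ℝ) (hH0 : 0 < H) (hH : ∀ μ ∈ OperatorScaling.complexSpectrum E, H < μ.re)
    {Ω : Type*} [MeasurableSpace Ω] (P : Measure Ω) [IsProbabilityMeasure P]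
    (κ : ℝ) (hκ : 0 < κ) (W : Set (OperatorScaling.Rd d) → Ω → ℂ)
    (hW : OperatorScaling.IsIsotropicStableMeasure α κ P W) :
    (∃ X : OperatorScaling.Rd d → Ω → ℝ,
      OperatorScaling.IsHarmonizableField E α H ψ P W X) ∧
    ∀ X : OperatorScaling.Rd d → Ω → ℝ,
      OperatorScaling.IsHarmonizableField E α H ψ P W X →
        OperatorScaling.IsOperatorScaling P E H X ∧
        OperatorScaling.HasStationaryIncrements P X := by
  refine ⟨?_, fun X hX => ⟨hX.isOperatorScaling hW hα0 hψ_cont hψ_hom hψ_nonneg,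
    hX.hasStationaryIncrements hW hα0 hψ_cont⟩⟩
  choose Y hY using fun x => hW.exists_isStableIntegral hα0 hκ
    (OperatorScaling.measurable_harmonizableKernel (E := E) (α := α) (H := H) hψ_cont x)
    (OperatorScaling.memLp_harmonizableKernel hα0 hH0 hH hψ_cont hψ_hom
      (fun ξ hξ => (hψ_nonneg ξ).lt_of_ne' (hψ_ne ξ hξ)) x)
  exact ⟨fun x ω => (Y x ω).re, fun x => ⟨Y x, hY x, ae_eq_refl _⟩⟩
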